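/- Let $n \ge 1$ be an integer, let $\mathbb F_q$ be a finite field with $q$ elements, and for $k \ge 0$ write $G_k = \mathrm{GL}(k,q)$ (with $G_0$ the trivial group) and $G = G_n$. Let $\hat\omega$ be the permutation character of $G$ on its natural module $\mathbb F_q^n$, i.e. $\hat\omega(g) = |\{v \in \mathbb F_q^n : gv = v\}|$. For $k \ge 0$ let $$\mathrm{St}_k = \sum_{J \subseteq \{1,\dots,k-1\}} (-1)^{|J|}\, (1_{P_J})^{G_k}$$ be the Steinberg character of $G_k$, where $P_J$ is the stabilizer in $G_k$ of the spans of the first $d$ standard basis vectors for all $d \in \{1,\dots,k-1\}\setminus J$, and put $\mathrm{St} = \mathrm{St}_n$. Fix a non-trivial homomorphism $\nu : (\mathbb F_q,+) \to \mathbb C^*$ and let $\gamma_k = \lambda^{G_k}$ be the Gelfand–Graev character of $G_k$, where $\lambda(u) = \prod_{i=1}^{k-1} \nu(u_{i,i+1})$ for $u$ in the group $U_k$ of upper triangular unipotent matrices of $G_k$. For $0 \le m \le n$ let $P_m \le G$ be the standard parabolic subgroup of type $(m,n-m)$, consisting of the block upper triangular matrices with diagonal blocks in $G_m$ and $G_{n-m}$.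 For class functions $\chi$ of $G_m$ and $\psi$ of $G_{n-m}$, let $\mathrm{Infl}_{P_m}(\chi \boxtimes \psi)$ be the class function of $P_m$ sending a matrix with diagonal blocks $a \in G_m$, $b \in G_{n-m}$ to $\chi(a)\psi(b)$. Then $$\hat\omega \cdot \mathrm{St} = \sum_{m=0}^n \left(\mathrm{Infl}_{P_m}\left(\mathrm{St}_m \boxtimes \gamma_{n-m}\right)\right)^G .$$ -/

import Mathlib

open Matrix

namespace GLChar

/-- The induced class function `φ^G`, for a class function `φ` on a subgroup `H` of a finite
group `G`: `φ^G(g) = |H|⁻¹ ∑_{x ∈ G} φ°(x⁻¹ g x)`, where `φ°` extends `φ` by zero. -/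
noncomputable def induced {G : Type*} [Group G] [Fintype G] (H : Subgroup G) (φ : H → ℂ) :
    G → ℂ :=
  open Classical in
  fun g => (Nat.card H : ℂ)⁻¹ *
    ∑ x : G, if h : x⁻¹ * g * x ∈ H then φ ⟨x⁻¹ * g * x, h⟩ else 0

section Groups

variable (F : Type*) [Field F] (n : ℕ)

/-- The permutation character of `GL(n, F)` on its natural module `F^n` of column vectors:
the number of fixed vectors. -/
noncomputable def permChar (g : GL (Fin n) F) : ℂ :=
  (Nat.card {v : Fin n → F // (g : Matrix (Fin n) (Fin n) F) *ᵥ v = v} : ℂ)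

/-- The standard parabolic subgroup of `GL(n, F)` of type `(m, n - m)`: the block upper
triangular matrices whose lower left block (rows `≥ m`, columns `< m`, counted from `0`)
vanishes. It is the stabilizer of the span of the first `m` standard basis vectors. -/
def parabolic (m : ℕ) : Subgroup (GL (Fin n) F) where
  carrier := {g | ∀ i j : Fin n, (j : ℕ) < m → m ≤ (i : ℕ) → g.val i j = 0}
  one_mem' := by
    intro i j hj hi
    have h : i ≠ j := by rintro rfl; omega
    simp [Matrix.one_apply, h]
  mul_mem' := by
    intro a b ha hb i j hj hi
    simp only [Units.val_mul, Matrix.mul_apply]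
    refine Finset.sum_eq_zero fun k _ => ?_
    by_cases hk : (k : ℕ) < m
    · rw [ha i k hk hi, zero_mul]
    · rw [hb k j hj (by omega), mul_zero]
  inv_mem' := by
    intro a ha i j hj hi
    let b : Fin n → ℕ := fun k => if (k : ℕ) < m then 0 else 1
    have hb : BlockTriangular a.val b := by
      intro i j hij
      simp only [b] at hij
      by_cases hi : (i : ℕ) < m <;> by_cases hj : (j : ℕ) < m <;> simp_all
    let _ : Invertible a.val := a.invertible
    have h := blockTriangular_inv_of_blockTriangular hb
    rw [Matrix.coe_units_inv]
    apply h
    simp [b, hj, not_lt.mpr hi]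

/-- The standard parabolic subgroup `P_J` for a set `J ⊆ {1, …, n - 1}` of simple reflections
(`d` standing for the transposition of `d` and `d + 1`): the stabilizer of the standard flag
formed by the spans of the first `d` basis vectors for `d ∈ {1, …, n - 1}` outside `J`.
Thus `P_∅` is the Borel subgroup of upper triangular matrices, and `P_J` is the whole group
for `J = {1, …, n - 1}`. -/
def parabolicJ (J : Finset ℕ) : Subgroup (GL (Fin n) F) :=
  ⨅ d ∈ Finset.Ico 1 n \ J, parabolic F n d

/-- The group `U_n` of upper triangular unipotent matrices. -/
def unipotent : Subgroup (GL (Fin n) F) where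
  carrier := {g | (∀ i, g.val i i = 1) ∧ ∀ i j : Fin n, j < i → g.val i j = 0}
  one_mem' := by
    refine ⟨fun i => by simp, fun i j hij => ?_⟩
    simp [Matrix.one_apply, hij.ne']
  mul_mem' := by
    rintro a b ⟨ha, ha'⟩ ⟨hb, hb'⟩
    refine ⟨fun i => ?_, fun i j hij => ?_⟩
    · simp only [Units.val_mul, Matrix.mul_apply]
      rw [Finset.sum_eq_single i, ha, hb, one_mul]
      · intro k _ hk
        rcases lt_or_gt_of_ne hk with h | h
        · rw [ha' i k h, zero_mul]
        · rw [hb' k i h, mul_zero]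
      · simp
    · simp only [Units.val_mul, Matrix.mul_apply]
      refine Finset.sum_eq_zero fun k _ => ?_
      rcases lt_or_ge k i with h | h
      · rw [ha' i k h, zero_mul]
      · rw [hb' k j (lt_of_lt_of_le hij h), mul_zero]
  inv_mem' := by
    rintro a ⟨ha, ha'⟩
    let _ : Invertible a.val := a.invertible
    have h' : ∀ i j : Fin n, j < i → (a⁻¹).val i j = 0 := by
      intro i j hij
      have hb : BlockTriangular a.val id := fun i j hij => ha' i j hij
      rw [Matrix.coe_units_inv]
      exact blockTriangular_inv_of_blockTriangular hb hij
    refine ⟨fun i => ?_, h'⟩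
    have h1 : (a.val * (a⁻¹).val) i i = 1 := by simp
    rw [Matrix.mul_apply, Finset.sum_eq_single i, ha, one_mul] at h1
    · exact h1
    · intro k _ hk
      rcases lt_or_gt_of_ne hk with h | h
      · rw [ha' i k h, zero_mul]
      · rw [h' k i h, mul_zero]
    · simp

variable {F n}

/-- The linear character `λ(u) = ∏_{i=1}^{n-1} ν(u_{i,i+1})` of `U_n` attached to an additive
character `ν` of `F`. -/
noncomputable def unipotentChar (ν : AddChar F ℂ) (u : unipotent F n) : ℂ :=
  ∏ i : Fin (n - 1), ν (u.val.val ⟨i, by omega⟩ ⟨i + 1, by omega⟩)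

/-- The upper left block, as a homomorphism from the parabolic of type `(m, n - m)`
to `GL(m, F)`. -/
def leviFst {m : ℕ} (h : m ≤ n) : parabolic F n m →* GL (Fin m) F :=
  MonoidHom.toHomUnits
    { toFun := fun p => p.val.val.submatrix (Fin.castLE h) (Fin.castLE h)
      map_one' := by
        simpa using Matrix.submatrix_one (α := F) _ (Fin.castLE_injective h)
      map_mul' := by
        rintro ⟨a, ha⟩ ⟨b, hb⟩
        ext i j
        simp only [Subgroup.coe_mul, Units.val_mul, Matrix.submatrix_apply, Matrix.mul_apply]
        symm
        refine Finset.sum_of_injOn (Fin.castLE h) (Fin.castLE_injective h).injOn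
          (by simp) ?_ (by simp)
        intro k _ hk
        have hk' : m ≤ (k : ℕ) := by
          by_contra hlt
          exact hk ⟨⟨k, by omega⟩, by simp, by ext; simp⟩
        rw [hb k _ (by simp) hk', mul_zero] }

/-- The lower right block, as a homomorphism from the parabolic of type `(m, n - m)`
to `GL(n - m, F)`. -/
def leviSnd {m : ℕ} (_h : m ≤ n) : parabolic F n m →* GL (Fin (n - m)) F :=
  MonoidHom.toHomUnits
    { toFun := fun p => Matrix.of fun i j : Fin (n - m) =>
        p.val.val ⟨m + i, by omega⟩ ⟨m + j, by omega⟩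
      map_one' := by
        ext i j
        simp [Matrix.one_apply, Fin.ext_iff]
      map_mul' := by
        rintro ⟨a, ha⟩ ⟨b, hb⟩
        ext i j
        simp only [Subgroup.coe_mul, Units.val_mul, Matrix.of_apply, Matrix.mul_apply]
        symm
        refine Finset.sum_of_injOn (fun k : Fin (n - m) => (⟨m + k, by omega⟩ : Fin n))
          (fun x _ y _ hxy => by simpa [Fin.ext_iff] using hxy) (by simp) ?_ (by simp)
        intro k _ hk
        have hk' : (k : ℕ) < m := by
          by_contra hlt
          exact hk ⟨⟨k - m, by omega⟩, by simp, by ext; simp; omega⟩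
        rw [ha _ k hk' (by simp), zero_mul] }

/-- `Infl_{P_m}(χ ⊠ ψ)`: the outer tensor product of a class function `χ` of `GL(m, F)` and a
class function `ψ` of `GL(n - m, F)`, pulled back along the projection of the parabolic
`P_m` onto its Levi quotient `GL(m, F) × GL(n - m, F)`. -/
def inflated {m : ℕ} (h : m ≤ n) (χ : GL (Fin m) F → ℂ) (ψ : GL (Fin (n - m)) F → ℂ) :
    parabolic F n m → ℂ :=
  fun p => χ (leviFst h p) * ψ (leviSnd h p)

variable [Fintype F] [DecidableEq F]

variable (F n) in
/-- The Steinberg character of `GL(n, F)`: the alternating sum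
`∑_{J ⊆ {1, …, n-1}} (-1)^{|J|} (1_{P_J})^G` over the standard parabolic subgroups. -/
noncomputable def steinberg : GL (Fin n) F → ℂ :=
  ∑ J ∈ (Finset.Ico 1 n).powerset, (-1 : ℂ) ^ J.card • induced (parabolicJ F n J) (fun _ => 1)

variable (n) in
/-- The Gelfand-Graev character of `GL(n, F)`: the character induced from the linear character
of `U_n` attached to a (nontrivial) additive character `ν` of `F`. -/
noncomputable def gelfandGraev (ν : AddChar F ℂ) : GL (Fin n) F → ℂ :=
  induced (unipotent F n) (unipotentChar ν)

end Groups

end GLChar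

/-!
For `g ∈ GL(n, q)` the value `St(g)` is `(-1)^n μ(0, V)`, where `μ` is the Möbius function of the
lattice of `g`-invariant subspaces of `V = F_q^n`. Indeed, sorting the subsets `J` in the
alternating sum by the largest element of their complement gives a recursion for `St`
(`GLChar.steinberg_recursion`), which is the recursion `∑_X μ(0, X) = 0` because the cosets of
`P_m` are the subspaces of dimension `m` (`GLChar.steinberg_eq_steinbergEnd`).

Suppose that `g` has last row `(0, …, 0, 1)`, upper left block `a` and remaining last column `v`.
Then the first `n - 1` basis vectors span an invariant hyperplane, a coatom of a modular lattice,
and Weisner's theorem gives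
`St_n(g) = |{w : a w + v = w}| · St_{n-1}(a)` (`GLChar.steinbergEnd_toLin'_of_last_row`).
By Fourier analysis, the number of fixed points is `∑_{φ a = φ} ν(φ v)`, the sum being over row
vectors `φ`. The term `φ = 0` contributes `St_{n-1}(a)`. The other `φ` are permuted transitively
by `GL(n-1, q)`, so that they contribute a class function induced from the stabilizer of one row
vector, twisted by `ν`.

This description is applied repeatedly. Let `R_m ≤ P_m` be the subgroup of matrices with upper
left block in `GL(m, q)` and lower right block in `U_{n-m}`, with the character `λ_m` of `R_m`
obtained from the superdiagonal entries of the lower right block. By transitivity of induction, the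
`m`-th summand on the right is `D_m = (St_m ⊗ λ_m)^G`, induced from `R_m`. Let `E_m` be the same
with `St_m` replaced by the restriction of `St_{m+1}` to the upper left block of size `m + 1`. Then
`E_0 = D_0` and `E_m = D_m + E_{m-1}` (`GLChar.induced_blockChar_succ`), while
`E_{n-1} = St · (ω̂ - 1)`, as `R_{n-1}` is the stabilizer of a nonzero row vector. Since
`D_n = St`, summing up gives the theorem.
-/

namespace GLChar

/-! ### The Möbius function of a finite poset -/

open Classical in
/-- The Möbius function of a finite partial order, with complex values. It is Mathlib's
`IncidenceAlgebra.mu`, freed from the choice of finiteness and decidability instances. -/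
noncomputable def moebius {α : Type*} [PartialOrder α] [Finite α] (a b : α) : ℂ :=
  letI := Fintype.ofFinite α
  letI := Fintype.toLocallyFiniteOrder (α := α)
  IncidenceAlgebra.mu ℂ a b

section Moebius

variable {α : Type*} [PartialOrder α]

open Classical in
lemma sum_moebius_right [Fintype α] (a b : α) :
    ∑ x with a ≤ x ∧ x ≤ b, moebius a x = if a = b then 1 else 0 := by
  let _ := Fintype.toLocallyFiniteOrder (α := α)
  convert IncidenceAlgebra.sum_Icc_mu_right (𝕜 := ℂ) a b using 2
  · ext; simp
  · unfold moebius; congr!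

open Classical in
lemma sum_moebius_left [Fintype α] (a b : α) :
    ∑ x with a ≤ x ∧ x ≤ b, moebius x b = if a = b then 1 else 0 := by
  let _ := Fintype.toLocallyFiniteOrder (α := α)
  convert IncidenceAlgebra.sum_Icc_mu_left (𝕜 := ℂ) a b using 2
  · ext; simp
  · unfold moebius; congr!

open Classical in
lemma moebius_eq_neg_sum [Fintype α] {a b : α} (h : a < b) :
    moebius a b = -∑ x with a ≤ x ∧ x < b, moebius a x := by
  have h1 := sum_moebius_right a b
  have h2 : Finset.univ.filter (fun x => a ≤ x ∧ x ≤ b) =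
      insert b (Finset.univ.filter (fun x => a ≤ x ∧ x < b)) := by
    ext x
    simp only [Finset.mem_filter, Finset.mem_univ, true_and, Finset.mem_insert]
    constructor
    · rintro ⟨hx, hx'⟩
      rcases hx'.eq_or_lt with rfl | hx'
      · exact Or.inl rfl
      · exact Or.inr ⟨hx, hx'⟩
    · rintro (rfl | ⟨hx, hx'⟩)
      · exact ⟨h.le, le_rfl⟩
      · exact ⟨hx, hx'.le⟩
  rw [h2, Finset.sum_insert (by simp), if_neg h.ne] at h1
  linear_combination h1

/-- The value `moebius a b` depends only on the isomorphism type of the interval `[a, b]`. -/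
lemma moebius_congr [Finite α] {β : Type*} [PartialOrder β] [Finite β] {a b : α} {c d : β}
    (hab : a ≤ b) (e : Set.Icc a b ≃o Set.Icc c d) : moebius a b = moebius c d := by
  classical
  have hcd : c ≤ d := (e ⟨a, le_rfl, hab⟩).2.1.trans (e ⟨a, le_rfl, hab⟩).2.2
  have := Fintype.ofFinite α
  have := Fintype.ofFinite β
  have bot : e ⟨a, le_rfl, hab⟩ = ⟨c, le_rfl, hcd⟩ := by
    apply le_antisymm
    · rw [← e.le_symm_apply]
      exact (e.symm ⟨c, le_rfl, hcd⟩).2.1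
    · exact (e _).2.1
  have top : e ⟨b, hab, le_rfl⟩ = ⟨d, hcd, le_rfl⟩ := by
    apply le_antisymm
    · exact (e _).2.2
    · rw [← e.symm_apply_le]
      exact (e.symm ⟨d, hcd, le_rfl⟩).2.2
  suffices H : ∀ x : α, ∀ hx : x ∈ Set.Icc a b, moebius a x = moebius c (e ⟨x, hx⟩ : β) by
    rw [H b ⟨hab, le_rfl⟩, top]
  intro x
  induction x using WellFoundedLT.induction with
  | ind x ih =>
    intro hx
    rcases hx.1.eq_or_lt with rfl | hax
    · rw [bot]
      have h1 := sum_moebius_right a a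
      have h2 := sum_moebius_right c c
      rw [Finset.sum_eq_single a] at h1
      · rw [Finset.sum_eq_single c] at h2
        · simp only [if_true] at h1 h2
          rw [h1, h2]
        · intro y hy hne
          simp only [Finset.mem_filter, Finset.mem_univ, true_and] at hy
          exact absurd (le_antisymm hy.2 hy.1) hne
        · simp
      · intro y hy hne
        simp only [Finset.mem_filter, Finset.mem_univ, true_and] at hy
        exact absurd (le_antisymm hy.2 hy.1) hne
      · simp
    · have hcx : c < (e ⟨x, hx⟩ : β) := by
        have h1 : e ⟨a, le_rfl, hab⟩ < e ⟨x, hx⟩ := e.lt_iff_lt.2 hax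
        rw [bot] at h1
        exact h1
      rw [moebius_eq_neg_sum hax, moebius_eq_neg_sum hcx]
      congr 1
      have hy' : ∀ y ∈ Finset.univ.filter (fun y => a ≤ y ∧ y < x), y ∈ Set.Icc a b := by
        intro y hy
        have hy := (Finset.mem_filter.1 hy).2
        exact ⟨hy.1, hy.2.le.trans hx.2⟩
      have hz' : ∀ z ∈ Finset.univ.filter (fun z => c ≤ z ∧ z < (e ⟨x, hx⟩ : β)),
          z ∈ Set.Icc c d := by
        intro z hz
        have hz := (Finset.mem_filter.1 hz).2
        exact ⟨hz.1, hz.2.le.trans (e ⟨x, hx⟩).2.2⟩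
      refine Finset.sum_bij' (fun y hy => (e ⟨y, hy' y hy⟩ : β))
        (fun z hz => (e.symm ⟨z, hz' z hz⟩ : α)) ?_ ?_ ?_ ?_ ?_
      · intro y hy
        have hyx := (Finset.mem_filter.1 hy).2.2
        exact Finset.mem_filter.2 ⟨Finset.mem_univ _, (e _).2.1,
          (e.lt_iff_lt (x := ⟨y, hy' y hy⟩) (y := ⟨x, hx⟩)).2 hyx⟩
      · intro z hz
        refine Finset.mem_filter.2 ⟨Finset.mem_univ _, (e.symm _).2.1, ?_⟩
        have h1 : e.symm ⟨z, hz' z hz⟩ < e.symm (e ⟨x, hx⟩) :=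
          e.symm.lt_iff_lt.2 (Finset.mem_filter.1 hz).2.2
        rw [e.symm_apply_apply] at h1
        exact h1
      · intro y hy
        simp
      · intro z hz
        simp
      · intro y hy
        exact ih y (Finset.mem_filter.1 hy).2.2 (hy' y hy)

end Moebius

section Weisner

variable {α : Type*} [Lattice α] [BoundedOrder α]

open Classical in
/-- Weisner's theorem: the sum over `y ≤ x ⊓ w` of `moebius ⊥ y` detects `x ⊓ w = ⊥`, and
exchanging the sums leaves a sum over `y ≤ w < ⊤` of terms `∑_{x ≥ y} moebius x ⊤ = 0`. -/
lemma sum_moebius_inf_eq_bot [Fintype α] {w : α} (hw : w ≠ ⊤) :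
    ∑ x with x ⊓ w = ⊥, moebius x ⊤ = 0 := by
  have h1 : ∀ x : α, (if x ⊓ w = ⊥ then moebius x ⊤ else 0) =
      ∑ y, if y ≤ w ∧ y ≤ x then moebius ⊥ y * moebius x ⊤ else 0 := by
    intro x
    have := sum_moebius_right ⊥ (x ⊓ w)
    simp only [bot_le, true_and, le_inf_iff] at this
    rw [← Finset.sum_filter, ← Finset.sum_mul]
    simp only [and_comm] at this ⊢
    rw [this]
    simp [eq_comm]
  rw [Finset.sum_filter, Finset.sum_congr rfl fun x _ => h1 x, Finset.sum_comm]
  refine Finset.sum_eq_zero fun y _ => ?_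
  have h2 := sum_moebius_left y (⊤ : α)
  by_cases hy : y ≤ w
  · rw [if_neg (by rintro rfl; exact hw (top_le_iff.1 hy)), Finset.sum_filter] at h2
    simp only [le_top, and_true] at h2
    have : ∀ x : α, (if y ≤ w ∧ y ≤ x then moebius ⊥ y * moebius x ⊤ else 0) =
        moebius ⊥ y * if y ≤ x then moebius x ⊤ else 0 := by
      intro x; simp [hy]
    rw [Finset.sum_congr rfl fun x _ => this x, ← Finset.mul_sum, h2, mul_zero]
  · simp [hy]

open Classical in
/-- In a finite modular lattice with a coatom `w`, Weisner's theorem expresses the Möbius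
number through the number of complements of `w`, since `[z, ⊤] ≃ [⊥, w]` for a complement `z`. -/
lemma moebius_bot_top_of_isCoatom [Finite α] [IsModularLattice α] {w : α} (hw : IsCoatom w) :
    moebius (⊥ : α) ⊤ = -(Nat.card {z : α // IsCompl z w} * moebius ⊥ w) := by
  have := Fintype.ofFinite α
  have h := sum_moebius_inf_eq_bot hw.1
  have h2 : Finset.univ.filter (fun x => x ⊓ w = ⊥) =
      insert ⊥ (Finset.univ.filter (fun x => IsCompl x w)) := by
    ext x
    simp only [Finset.mem_filter, Finset.mem_univ, true_and, Finset.mem_insert]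
    constructor
    · intro hx
      by_cases hxw : x ≤ w
      · left; rwa [inf_eq_left.2 hxw] at hx
      · right
        exact ⟨disjoint_iff.2 hx, codisjoint_iff.2 (hw.2 _ (right_lt_sup.2 hxw))⟩
    · rintro (rfl | hx)
      · simp
      · exact hx.inf_eq_bot
  rw [h2, Finset.sum_insert] at h
  · rw [Finset.sum_congr rfl (g := fun _ => moebius ⊥ w), Finset.sum_const] at h
    · rw [Nat.card_eq_fintype_card, Fintype.card_subtype]
      rw [nsmul_eq_mul] at h
      linear_combination h
    · intro z hz
      have hz : IsCompl z w := by simpa using hz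
      symm
      apply moebius_congr bot_le
      refine (OrderIso.setCongr _ _ ?_).trans ((infIccOrderIsoIccSup w z).trans
        (OrderIso.setCongr _ _ ?_))
      · rw [hz.symm.inf_eq_bot]
      · rw [hz.symm.sup_eq_top]
  · simp only [Finset.mem_filter, Finset.mem_univ, true_and]
    intro hb
    exact hw.1 (by simpa using hb.sup_eq_top)

end Weisner

/-! ### Möbius numbers of lattices of invariant subspaces -/

section Endomorphism

variable {F V V' : Type*} [Field F] [AddCommGroup V] [Module F V] [AddCommGroup V'] [Module F V']

instance (f : Module.End F V) : IsModularLattice f.invtSubmodule where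
  sup_inf_le_assoc_of_le {X} Y {Z} h := by
    change ((X : Submodule F V) ⊔ Y) ⊓ Z ≤ X ⊔ (Y ⊓ Z)
    exact sup_inf_le_assoc_of_le _ h

/-- If `f` preserves a nonzero linear form `l`, the invariant complements of the hyperplane
`ker l` are the lines spanned by the fixed vectors `x` with `l x = 1`. -/
lemma card_isCompl_ker (f : Module.End F V) (l : V →ₗ[F] F) (hl : l ≠ 0)
    (hlf : ∀ x, l (f x) = l x) (hW : LinearMap.ker l ∈ f.invtSubmodule) :
    Nat.card {X : f.invtSubmodule // IsCompl X ⟨LinearMap.ker l, hW⟩} =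
      Nat.card {x : V // l x = 1 ∧ f x = x} := by
  symm
  have key : ∀ x : V, l x = 1 → IsCompl (Submodule.span F {x}) (LinearMap.ker l) := by
    intro x hx
    constructor
    · rw [Submodule.disjoint_def]
      intro y hy hy'
      obtain ⟨c, rfl⟩ := Submodule.mem_span_singleton.1 hy
      have : c = 0 := by simpa [hx] using hy'
      simp [this]
    · rw [codisjoint_iff, eq_top_iff]
      intro y _
      refine Submodule.mem_sup.2 ⟨l y • x, Submodule.mem_span_singleton.2 ⟨_, rfl⟩,
        y - l y • x, ?_, by simp⟩
      simp [hx]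
  refine Nat.card_congr (Equiv.ofBijective (fun x => ⟨⟨Submodule.span F {x.1}, ?_⟩, ?_⟩) ⟨?_, ?_⟩)
  · rw [Module.End.mem_invtSubmodule, Submodule.span_singleton_le_iff_mem, Submodule.mem_comap,
      x.2.2]
    exact Submodule.mem_span_singleton_self _
  · rw [Module.End.invtSubmodule.isCompl_iff]
    exact key x.1 x.2.1
  · rintro ⟨x, hx⟩ ⟨y, hy⟩ hxy
    have h1 : Submodule.span F {x} = Submodule.span F {y} :=
      congrArg (fun X => ((X.1 : f.invtSubmodule) : Submodule F V)) hxy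
    have h2 : x ∈ Submodule.span F {y} := h1 ▸ Submodule.mem_span_singleton_self _
    obtain ⟨c, rfl⟩ := Submodule.mem_span_singleton.1 h2
    have : c = 1 := by simpa [hy.1] using hx.1
    simp [this]
  · rintro ⟨⟨X, hX⟩, hXW⟩
    rw [Module.End.invtSubmodule.isCompl_mk_iff] at hXW
    obtain ⟨y, hy⟩ : ∃ y, l y ≠ 0 := by
      by_contra! h
      exact hl (LinearMap.ext h)
    obtain ⟨x, hx, w, hw, rfl⟩ := Submodule.mem_sup.1
      (show y ∈ X ⊔ LinearMap.ker l by rw [hXW.sup_eq_top]; trivial)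
    have hw : l w = 0 := hw
    rw [map_add, hw, add_zero] at hy
    have hone : l ((l x)⁻¹ • x) = 1 := by simp [hy]
    have hmem : (l x)⁻¹ • x ∈ X := X.smul_mem _ hx
    set z := (l x)⁻¹ • x with hz
    have huniq : ∀ u ∈ X, u = l u • z := by
      intro u hu
      have : u - l u • z ∈ X ⊓ LinearMap.ker l :=
        ⟨X.sub_mem hu (X.smul_mem _ hmem), by simp [hone]⟩
      rw [hXW.inf_eq_bot, Submodule.mem_bot, sub_eq_zero] at this
      exact this
    have hfix : f z = z := by
      rw [huniq (f z) (hX hmem), hlf, hone, one_smul]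
    refine ⟨⟨z, hone, hfix⟩, ?_⟩
    apply Subtype.ext
    apply Subtype.ext
    change Submodule.span F {z} = X
    apply le_antisymm
    · rwa [Submodule.span_singleton_le_iff_mem]
    · intro u hu
      rw [huniq u hu]
      exact Submodule.smul_mem _ _ (Submodule.mem_span_singleton_self _)

variable [Finite V] [Finite V']

/-- The signed Möbius number `(-1)^{dim V} μ(0, V)` of the lattice of `f`-invariant subspaces
of `V`. For invertible `f` this is the value of the Steinberg character. -/
noncomputable def steinbergEnd (f : Module.End F V) : ℂ :=
  (-1) ^ Module.finrank F V * moebius (⊥ : f.invtSubmodule) ⊤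

lemma steinbergEnd_conj (e : V ≃ₗ[F] V') (f : Module.End F V) (f' : Module.End F V')
    (h : ∀ x, e (f x) = f' (e x)) : steinbergEnd f = steinbergEnd f' := by
  have h' : ∀ y, e.symm (f' y) = f (e.symm y) := by
    intro y
    rw [e.symm_apply_eq, h, e.apply_symm_apply]
  unfold steinbergEnd
  rw [e.finrank_eq]
  congr 1
  apply moebius_congr bot_le
  refine
    { toFun := fun X => ⟨⟨(X.1 : Submodule F V).map (e : V →ₗ[F] V'), ?_⟩, bot_le, le_top⟩
      invFun := fun Y => ⟨⟨(Y.1 : Submodule F V').map (e.symm : V' →ₗ[F] V), ?_⟩, bot_le, le_top⟩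
      left_inv := ?_
      right_inv := ?_
      map_rel_iff' := ?_ }
  · rintro _ ⟨x, hx, rfl⟩
    refine ⟨f x, X.1.2 hx, ?_⟩
    exact h x
  · rintro _ ⟨x, hx, rfl⟩
    refine ⟨f' x, Y.1.2 hx, ?_⟩
    exact h' x
  · intro X
    ext x
    simp
  · intro Y
    ext x
    simp
  · intro X Y
    exact Submodule.map_le_map_iff_of_injective e.injective _ _

/-- The invariant subspaces inside an invariant subspace `X` are those of the restriction. -/
lemma moebius_invtSubmodule (f : Module.End F V) {X : Submodule F V} (hX : X ∈ f.invtSubmodule) :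
    moebius (⊥ : f.invtSubmodule) ⟨X, hX⟩ =
      moebius (⊥ : Module.End.invtSubmodule (f.restrict hX)) ⊤ := by
  symm
  apply moebius_congr bot_le
  refine
    { toFun := fun Y => ⟨⟨(Y.1 : Submodule F X).map X.subtype, ?_⟩, bot_le, ?_⟩
      invFun := fun Z => ⟨⟨(Z.1 : Submodule F V).comap X.subtype, ?_⟩, bot_le, le_top⟩
      left_inv := ?_
      right_inv := ?_
      map_rel_iff' := ?_ }
  · exact Module.End.invtSubmodule.map_subtype_mem_of_mem_invtSubmodule f hX Y.1.2
  · exact Submodule.map_subtype_le X _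
  · intro x hx
    exact Z.1.2 hx
  · intro Y
    ext x
    simp
  · intro Z
    have hZ : (Z.1 : Submodule F V) ≤ X := Z.2.2
    ext x
    simp only [Submodule.map_comap_subtype, Submodule.mem_inf]
    exact ⟨fun h => h.2, fun h => ⟨hZ h, h⟩⟩
  · intro Y Z
    exact Submodule.map_le_map_iff_of_injective X.subtype_injective _ _

lemma moebius_invtSubmodule_eq (f : Module.End F V) {X : Submodule F V}
    (hX : X ∈ f.invtSubmodule) :
    moebius (⊥ : f.invtSubmodule) ⟨X, hX⟩ =
      (-1) ^ Module.finrank F X * steinbergEnd (f.restrict hX) := by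
  rw [moebius_invtSubmodule, steinbergEnd, ← mul_assoc, ← mul_pow]
  simp

open Classical in
/-- The value of `steinbergEnd` on the restriction of `f` to `X`, or `0` if `X` is not
invariant. -/
noncomputable def steinbergOn (f : Module.End F V) (X : Submodule F V) : ℂ :=
  if hX : X ∈ f.invtSubmodule then steinbergEnd (f.restrict hX) else 0

lemma steinbergOn_top (f : Module.End F V) : steinbergOn f ⊤ = steinbergEnd f := by
  rw [steinbergOn, dif_pos (Module.End.invtSubmodule.top_mem f)]
  exact steinbergEnd_conj Submodule.topEquiv _ _ fun x => rfl

/-- The defining recursion of the Möbius function, summed over all invariant subspaces. -/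
lemma sum_steinbergOn [Nontrivial V] [Fintype (Submodule F V)] (f : Module.End F V) :
    ∑ X : Submodule F V, (-1) ^ Module.finrank F X * steinbergOn f X = 0 := by
  classical
  have : Fintype f.invtSubmodule := Fintype.ofFinite _
  have hne : (⊥ : f.invtSubmodule) ≠ ⊤ := by
    intro h
    exact bot_ne_top (α := Submodule F V) (congrArg Subtype.val h)
  have h := sum_moebius_right (⊥ : f.invtSubmodule) ⊤
  rw [if_neg hne] at h
  rw [← h]
  symm
  refine Finset.sum_of_injOn Subtype.val Subtype.val_injective.injOn (by simp) ?_ ?_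
  · intro X _ hX
    rw [steinbergOn, dif_neg, mul_zero]
    intro hX'
    exact hX ⟨⟨X, hX'⟩, by simp, rfl⟩
  · rintro ⟨X, hX⟩ -
    rw [moebius_invtSubmodule_eq, steinbergOn, dif_pos hX]

/-- If `f` preserves a nonzero linear form `l`, then `ker l` is a coatom in the modular lattice
of invariant subspaces, and Weisner's theorem applies to it. -/
theorem steinbergEnd_eq_card_mul (f : Module.End F V) (l : V →ₗ[F] F) (hl : l ≠ 0)
    (hlf : ∀ x, l (f x) = l x) (hW : LinearMap.ker l ∈ f.invtSubmodule) :
    steinbergEnd f = Nat.card {x : V // l x = 1 ∧ f x = x} * steinbergEnd (f.restrict hW) := by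
  obtain ⟨y, hy⟩ : ∃ y, l y ≠ 0 := by
    by_contra! h
    exact hl (LinearMap.ext h)
  have hco : IsCoatom (⟨LinearMap.ker l, hW⟩ : f.invtSubmodule) := by
    constructor
    · intro h
      have h1 : LinearMap.ker l = ⊤ := congrArg Subtype.val h
      exact hl (LinearMap.ker_eq_top.1 h1)
    · rintro ⟨X, hX⟩ hlt
      obtain ⟨x, hx, hxl⟩ := SetLike.exists_of_lt (show LinearMap.ker l < X from hlt)
      have hxl : l x ≠ 0 := hxl
      apply Subtype.ext
      change X = ⊤
      rw [eq_top_iff]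
      intro u _
      have h1 : u - (l u * (l x)⁻¹) • x ∈ X :=
        (show LinearMap.ker l < X from hlt).le (by simp [hxl])
      have := X.add_mem h1 (X.smul_mem (l u * (l x)⁻¹) hx)
      simpa using this
  have hdim : Module.finrank F V = Module.finrank F (LinearMap.ker l) + 1 := by
    have h1 := LinearMap.finrank_range_add_finrank_ker l
    rw [LinearMap.range_eq_top.2 (LinearMap.surjective hl)] at h1
    simp at h1
    omega
  rw [steinbergEnd, moebius_bot_top_of_isCoatom hco, card_isCompl_ker f l hl hlf hW,
    moebius_invtSubmodule_eq, hdim, pow_succ]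
  have hs : ((-1 : ℂ) ^ Module.finrank F (LinearMap.ker l)) *
      (-1) ^ Module.finrank F (LinearMap.ker l) = 1 := by
    rw [← mul_pow]; simp
  linear_combination (Nat.card {x : V // l x = 1 ∧ f x = x} *
    steinbergEnd (f.restrict hW) : ℂ) * hs

end Endomorphism

/-! ### The signed Möbius number of a matrix -/

section MatrixForm

variable {F : Type*} [Field F]

lemma mulVec_snoc {m : ℕ} (A : Matrix (Fin (m + 1)) (Fin (m + 1)) F) (w : Fin m → F) (c : F)
    (i : Fin m) :
    (A *ᵥ (Fin.snoc w c : Fin (m + 1) → F)) i.castSucc =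
      (A.submatrix Fin.castSucc Fin.castSucc *ᵥ w) i + A i.castSucc (Fin.last m) * c := by
  simp [Matrix.mulVec, dotProduct, Fin.sum_univ_castSucc]

/-- Let `A` be a square matrix with last row `(0, …, 0, 1)`, with upper left block `a` and
remaining last column `v`. Then its signed Möbius number is that of `a` times the number of
fixed points of the affine map `w ↦ a w + v`. -/
theorem steinbergEnd_toLin'_of_last_row [Finite F] {m : ℕ} (A : Matrix (Fin (m + 1)) (Fin (m + 1)) F)
    (hA : ∀ j, A (Fin.last m) j = if j = Fin.last m then 1 else 0) :
    steinbergEnd (Matrix.toLin' A) =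
      Nat.card {w : Fin m → F // A.submatrix Fin.castSucc Fin.castSucc *ᵥ w +
        (fun i => A i.castSucc (Fin.last m)) = w} *
      steinbergEnd (Matrix.toLin' (A.submatrix Fin.castSucc Fin.castSucc)) := by
  let l : (Fin (m + 1) → F) →ₗ[F] F := LinearMap.proj (Fin.last m)
  have hlast : ∀ x, (A *ᵥ x) (Fin.last m) = x (Fin.last m) := by
    intro x
    simp [Matrix.mulVec, dotProduct, hA]
  have hl : l ≠ 0 := by
    intro h
    have := LinearMap.congr_fun h (Pi.single (Fin.last m) 1)
    simp [l] at this
  have hlf : ∀ x, l (Matrix.toLin' A x) = l x := by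
    intro x
    simpa [l] using hlast x
  have hW : LinearMap.ker l ∈ Module.End.invtSubmodule (Matrix.toLin' A) := by
    intro x hx
    simp only [Submodule.mem_comap, LinearMap.mem_ker] at hx ⊢
    rw [hlf, hx]
  rw [steinbergEnd_eq_card_mul _ l hl hlf hW]
  congr 1
  · congr 1
    refine Nat.card_congr ⟨fun x => ⟨fun i => x.1 i.castSucc, ?_⟩,
      fun w => ⟨Fin.snoc w.1 1, ?_, ?_⟩, ?_, ?_⟩
    · obtain ⟨x, hx1, hx2⟩ := x
      have hx : x = (Fin.snoc (fun i => x i.castSucc) 1 : Fin (m + 1) → F) := by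
        ext i
        refine Fin.lastCases ?_ (fun i => ?_) i
        · simpa [l] using hx1
        · simp
      ext i
      have h := mulVec_snoc A (fun i => x i.castSucc) 1 i
      rw [← hx, ← Matrix.toLin'_apply, hx2] at h
      simpa using h.symm
    · simp [l]
    · obtain ⟨w, hw⟩ := w
      ext i
      refine Fin.lastCases ?_ (fun i => ?_) i
      · rw [Matrix.toLin'_apply, hlast]
      · rw [Matrix.toLin'_apply, mulVec_snoc]
        simpa using congrFun hw i
    · rintro ⟨x, hx1, hx2⟩
      ext i
      refine Fin.lastCases ?_ (fun i => ?_) i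
      · simpa [l] using hx1.symm
      · simp
    · rintro ⟨w, hw⟩
      ext i
      simp
  · symm
    let e : (Fin m → F) ≃ₗ[F] LinearMap.ker l :=
      { toFun := fun w => ⟨(Fin.snoc w 0 : Fin (m + 1) → F), by simp [l]⟩
        invFun := fun x i => x.1 i.castSucc
        map_add' := by
          intro x y
          ext i
          refine Fin.lastCases ?_ (fun i => ?_) i <;> simp
        map_smul' := by
          intro c x
          ext i
          refine Fin.lastCases ?_ (fun i => ?_) i <;> simp
        left_inv := by
          intro w
          ext i
          simp
        right_inv := by
          rintro ⟨x, hx⟩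
          ext i
          refine Fin.lastCases ?_ (fun i => ?_) i
          · simpa [l] using hx.symm
          · simp }
    refine steinbergEnd_conj e _ _ fun w => ?_
    apply Subtype.ext
    change (Fin.snoc (Matrix.toLin' (A.submatrix Fin.castSucc Fin.castSucc) w) 0 :
      Fin (m + 1) → F) = Matrix.toLin' A (Fin.snoc w 0 : Fin (m + 1) → F)
    rw [Matrix.toLin'_apply, Matrix.toLin'_apply]
    ext i
    refine Fin.lastCases ?_ (fun i => ?_) i
    · simp [hlast]
    · rw [mulVec_snoc]
      simp

end MatrixForm

/-! ### Induced class functions -/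

section Induction

variable {G L : Type*} [Group G] [Fintype G] [Group L] [Fintype L]

open Classical in
lemma induced_apply (H : Subgroup G) (φ : H → ℂ) (g : G) :
    induced H φ g = (Nat.card H : ℂ)⁻¹ *
      ∑ x : G, if h : x⁻¹ * g * x ∈ H then φ ⟨x⁻¹ * g * x, h⟩ else 0 := by
  unfold induced
  congr!

open Classical in
/-- Induction of the restriction to `H` of a function defined on all of `G`. -/
lemma induced_restrict (H : Subgroup G) (f : G → ℂ) (g : G) :
    induced H (fun h => f h) g = (Nat.card H : ℂ)⁻¹ *
      ∑ x : G, if x⁻¹ * g * x ∈ H then f (x⁻¹ * g * x) else 0 := by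
  rw [induced_apply]
  simp

lemma natCast_card_ne_zero (H : Subgroup G) : (Nat.card H : ℂ) ≠ 0 := by
  have : Finite H := inferInstance
  exact_mod_cast Nat.card_pos.ne'

lemma induced_conj (H : Subgroup G) (φ : H → ℂ) (g y : G) :
    induced H φ (y⁻¹ * g * y) = induced H φ g := by
  classical
  rw [induced_apply, induced_apply]
  congr 1
  refine Fintype.sum_equiv (Equiv.mulLeft y) _ _ fun x => ?_
  have : x⁻¹ * (y⁻¹ * g * y) * x = ((Equiv.mulLeft y) x)⁻¹ * g * (Equiv.mulLeft y) x := by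
    simp [mul_assoc]
  simp only [this]

lemma induced_top (f : G → ℂ) (hf : ∀ g y, f (y⁻¹ * g * y) = f g) (g : G) :
    induced (⊤ : Subgroup G) (fun h => f h) g = f g := by
  classical
  rw [induced_restrict]
  simp [hf]

lemma induced_finset_sum {ι : Type*} (s : Finset ι) (H : Subgroup G) (φ : ι → H → ℂ) (g : G) :
    induced H (fun h => ∑ i ∈ s, φ i h) g = ∑ i ∈ s, induced H (φ i) g := by
  classical
  simp only [induced_apply]
  rw [← Finset.mul_sum s, Finset.sum_comm]
  congr 1
  refine Finset.sum_congr rfl fun x _ => ?_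
  split_ifs <;> simp

lemma induced_const_mul (c : ℂ) (H : Subgroup G) (φ : H → ℂ) (g : G) :
    induced H (fun h => c * φ h) g = c * induced H φ g := by
  classical
  simp only [induced_apply]
  rw [mul_left_comm c, Finset.mul_sum _ _ c]
  congr 1
  refine Finset.sum_congr rfl fun x _ => ?_
  split_ifs <;> simp

/-- Right translation by the elements `i k` does not change a sum over the group. -/
lemma card_mul_sum_eq_sum_sum {K : Type*} [Fintype K] (F : G → ℂ) (i : K → G) :
    (Fintype.card K : ℂ) * ∑ x, F x = ∑ x, ∑ k, F (x * i k) := by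
  rw [Finset.sum_comm]
  have h : ∀ k, ∑ x, F (x * i k) = ∑ x, F x := fun k =>
    Fintype.sum_equiv (Equiv.mulRight (i k)) _ _ fun x => rfl
  simp [h]

/-- If the fibres of a surjection `p : G → Ω` are the left cosets of `H`, then a sum over `G` of
a function of `p x` is `|H|` times a sum over `Ω`. -/
lemma sum_comp_eq_card_mul_sum {Ω : Type*} [Fintype Ω] (H : Subgroup G) (p : G → Ω)
    (hp : Function.Surjective p) (hH : ∀ x y, p x = p y ↔ x⁻¹ * y ∈ H) (f : Ω → ℂ) :
    ∑ x, f (p x) = Nat.card H * ∑ ω, f ω := by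
  classical
  rw [← Finset.sum_fiberwise (Finset.univ : Finset G) p, Finset.mul_sum]
  refine Finset.sum_congr rfl fun ω _ => ?_
  obtain ⟨x₀, rfl⟩ := hp ω
  rw [Finset.sum_congr rfl (g := fun _ => f (p x₀))
    (fun x hx => by rw [(Finset.mem_filter.1 hx).2]), Finset.sum_const, nsmul_eq_mul]
  congr 2
  rw [Nat.card_eq_fintype_card, ← Fintype.card_subtype]
  refine Fintype.card_congr ⟨fun x => ⟨x₀⁻¹ * x.1, (hH _ _).1 x.2.symm⟩,
    fun h => ⟨x₀ * h.1, ((hH _ _).2 (by simp)).symm⟩, fun x => by simp, fun h => by simp⟩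

/-- The sum over `L` is a multiple of the sum over a group that maps onto `L`. -/
lemma sum_comp_of_surjective {P : Type*} [Group P] [Fintype P] (π : P →* L)
    (hπ : Function.Surjective π) (f : L → ℂ) :
    ∑ x, f (π x) = Nat.card π.ker * ∑ l, f l := by
  refine sum_comp_eq_card_mul_sum π.ker π hπ (fun x y => ?_) f
  rw [MonoidHom.mem_ker, map_mul, map_inv, inv_mul_eq_one]

lemma card_comap_of_surjective {P : Type*} [Group P] [Finite P] (π : P →* L)
    (hπ : Function.Surjective π) (H : Subgroup L) :
    Nat.card (H.comap π) = Nat.card π.ker * Nat.card H := by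
  have h1 := Subgroup.index_comap_of_surjective H hπ
  have h2 := Subgroup.card_mul_index (H.comap π)
  have h3 := Subgroup.card_mul_index H
  have h4 := Subgroup.card_mul_index π.ker
  rw [Subgroup.index_ker, MonoidHom.range_eq_top.2 hπ, Subgroup.card_top] at h4
  rw [h1] at h2
  have h5 : H.index ≠ 0 := Subgroup.index_ne_zero_of_finite
  apply Nat.eq_of_mul_eq_mul_right (Nat.pos_of_ne_zero h5)
  rw [h2, ← h4, ← h3, mul_assoc]

/-- Inflation commutes with induction, and induction is transitive. Let `π : P → L` be
surjective, `P ≤ G`, and let `H'` be the subgroup of `G` formed by the elements of `P` which `π`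
sends to `H ≤ L`. Inducing `φ` from `H` to `L`, inflating to `P`, multiplying by a class function
`θ` of `P` and inducing to `G` amounts to inducing from `H'`. -/
theorem induced_mul_inflated_induced {P : Subgroup G} (π : P →* L)
    (hπ : Function.Surjective π) (H : Subgroup L) (f : L → ℂ) (θ : P → ℂ)
    (hθ : ∀ p q : P, θ (q⁻¹ * p * q) = θ p) (H' : Subgroup G) (hle : H' ≤ P)
    (hH' : ∀ p : P, (p : G) ∈ H' ↔ π p ∈ H) (g : G) :
    induced P (fun p => θ p * induced H (fun h => f h) (π p)) g =
      induced H' (fun h => θ ⟨h, hle h.2⟩ * f (π ⟨h, hle h.2⟩)) g := by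
  classical
  have hcard : Nat.card H' = Nat.card π.ker * Nat.card H := by
    rw [← card_comap_of_surjective π hπ H]
    refine Nat.card_congr ⟨fun h => ⟨⟨h.1, hle h.2⟩, (hH' ⟨h.1, hle h.2⟩).1 h.2⟩,
      fun p => ⟨p.1.1, (hH' p.1).2 p.2⟩, fun h => rfl, fun p => rfl⟩
  set E : G → ℂ := fun h => if hh : h ∈ H' then θ ⟨h, hle hh⟩ * f (π ⟨h, hle hh⟩) else 0 with hE
  have hR : induced H' (fun h => θ ⟨h, hle h.2⟩ * f (π ⟨h, hle h.2⟩)) g =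
      (Nat.card H' : ℂ)⁻¹ * ∑ x : G, E (x⁻¹ * g * x) := by
    rw [induced_apply]
  have hL : ∀ x : G, (if h : x⁻¹ * g * x ∈ P then
        θ ⟨x⁻¹ * g * x, h⟩ * induced H (fun h => f h) (π ⟨x⁻¹ * g * x, h⟩) else 0) =
      (Nat.card H' : ℂ)⁻¹ * ∑ p : P, E ((x * p)⁻¹ * g * (x * p)) := by
    intro x
    by_cases h : x⁻¹ * g * x ∈ P
    · rw [dif_pos h]
      set a : P := ⟨x⁻¹ * g * x, h⟩ with ha
      have h1 : ∀ p : P, E ((x * p)⁻¹ * g * (x * p)) = θ a *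
          if (π p)⁻¹ * π a * π p ∈ H then f ((π p)⁻¹ * π a * π p) else 0 := by
        intro p
        have h2 : (x * p)⁻¹ * g * (x * p) = ((p⁻¹ * a * p : P) : G) := by
          simp [ha, mul_assoc]
        have h3 : (π p)⁻¹ * π a * π p = π (p⁻¹ * a * p) := by simp
        rw [h2, h3, hE]
        by_cases h4 : ((p⁻¹ * a * p : P) : G) ∈ H'
        · simp only [dif_pos h4]
          rw [if_pos ((hH' _).1 h4), ← hθ a p]
        · simp only [dif_neg h4]
          rw [if_neg (fun h5 => h4 ((hH' _).2 h5)), mul_zero]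
      rw [Finset.sum_congr rfl fun p _ => h1 p, ← Finset.mul_sum,
        sum_comp_of_surjective π hπ
          (fun l => if l⁻¹ * π a * l ∈ H then f (l⁻¹ * π a * l) else 0),
        induced_restrict, hcard]
      have h6 : (Nat.card π.ker : ℂ) ≠ 0 := natCast_card_ne_zero _
      have h7 : (Nat.card H : ℂ) ≠ 0 := natCast_card_ne_zero _
      push_cast
      field_simp
    · rw [dif_neg h, Finset.sum_eq_zero, mul_zero]
      intro p _
      have h2 : (x * p)⁻¹ * g * (x * p) = (p : G)⁻¹ * (x⁻¹ * g * x) * p := by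
        simp [mul_assoc]
      rw [h2, hE]
      refine dif_neg fun h3 => h ?_
      have := P.mul_mem (P.mul_mem p.2 (hle h3)) (P.inv_mem p.2)
      simpa [mul_assoc] using this
  rw [hR, induced_apply, Finset.sum_congr rfl fun x _ => hL x, ← Finset.mul_sum,
    ← card_mul_sum_eq_sum_sum (fun x => E (x⁻¹ * g * x)) (fun p : P => (p : G)),
    ← Nat.card_eq_fintype_card]
  have h6 : (Nat.card P : ℂ) ≠ 0 := natCast_card_ne_zero _
  field_simp

end Induction

/-! ### Parabolic subgroups and the Steinberg character -/

section Parabolic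

variable {F : Type*} [Field F] {n : ℕ}

lemma mem_parabolic {m : ℕ} {g : GL (Fin n) F} :
    g ∈ parabolic F n m ↔ ∀ i j : Fin n, (j : ℕ) < m → m ≤ (i : ℕ) → g.val i j = 0 :=
  Iff.rfl

lemma mem_parabolicJ {J : Finset ℕ} {g : GL (Fin n) F} :
    g ∈ parabolicJ F n J ↔ ∀ d, 1 ≤ d → d < n → d ∉ J → g ∈ parabolic F n d := by
  simp only [parabolicJ, Subgroup.mem_iInf, Finset.mem_sdiff, Finset.mem_Ico]
  exact ⟨fun h d h1 h2 h3 => h d ⟨⟨h1, h2⟩, h3⟩, fun h d hd => h d hd.1.1 hd.1.2 hd.2⟩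

lemma parabolic_zero : parabolic F n 0 = ⊤ := by
  ext g
  simp [mem_parabolic]

@[simp]
lemma leviFst_apply {m : ℕ} (h : m ≤ n) (p : parabolic F n m) (i j : Fin m) :
    (leviFst h p).val i j = p.val.val (Fin.castLE h i) (Fin.castLE h j) := rfl

@[simp]
lemma leviSnd_apply {m : ℕ} (h : m ≤ n) (p : parabolic F n m) (i j : Fin (n - m)) :
    (leviSnd h p).val i j = p.val.val ⟨m + i, by omega⟩ ⟨m + j, by omega⟩ := rfl

/-- The decomposition of the index set of `F^n` into its first `m` and its last `n - m`
elements. -/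
def splitEquiv {m : ℕ} (h : m ≤ n) : Fin m ⊕ Fin (n - m) ≃ Fin n :=
  finSumFinEquiv.trans (finCongr (by omega))

lemma splitEquiv_inl {m : ℕ} (h : m ≤ n) (i : Fin m) :
    splitEquiv h (Sum.inl i) = Fin.castLE h i := by
  ext; simp [splitEquiv]

lemma splitEquiv_inr {m : ℕ} (h : m ≤ n) (i : Fin (n - m)) :
    splitEquiv h (Sum.inr i) = ⟨m + i, by omega⟩ := by
  ext; simp [splitEquiv]

/-- The block diagonal matrix with invertible diagonal blocks `a` and `b`. -/
def blockDiag {m : ℕ} (h : m ≤ n) (a : GL (Fin m) F) (b : GL (Fin (n - m)) F) :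
    GL (Fin n) F where
  val := Matrix.reindex (splitEquiv h) (splitEquiv h) (Matrix.fromBlocks a.val 0 0 b.val)
  inv := Matrix.reindex (splitEquiv h) (splitEquiv h)
    (Matrix.fromBlocks (a⁻¹).val 0 0 (b⁻¹).val)
  val_inv := by
    simp only [Matrix.reindex_apply, Matrix.submatrix_mul_equiv, Matrix.fromBlocks_multiply]
    simp
  inv_val := by
    simp only [Matrix.reindex_apply, Matrix.submatrix_mul_equiv, Matrix.fromBlocks_multiply]
    simp

lemma blockDiag_mem {m : ℕ} (h : m ≤ n) (a : GL (Fin m) F) (b : GL (Fin (n - m)) F) :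
    blockDiag h a b ∈ parabolic F n m := by
  intro i j hj hi
  obtain ⟨i, rfl⟩ := (splitEquiv h).surjective i
  obtain ⟨j, rfl⟩ := (splitEquiv h).surjective j
  rcases i with i | i
  · simp [splitEquiv_inl] at hi; omega
  · rcases j with j | j
    · simp [blockDiag]
    · simp [splitEquiv_inr] at hj

lemma leviFst_blockDiag {m : ℕ} (h : m ≤ n) (a : GL (Fin m) F) (b : GL (Fin (n - m)) F) :
    leviFst h ⟨blockDiag h a b, blockDiag_mem h a b⟩ = a := by
  ext i j
  rw [leviFst_apply, ← splitEquiv_inl h, ← splitEquiv_inl h]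
  simp [blockDiag]

lemma leviSnd_blockDiag {m : ℕ} (h : m ≤ n) (a : GL (Fin m) F) (b : GL (Fin (n - m)) F) :
    leviSnd h ⟨blockDiag h a b, blockDiag_mem h a b⟩ = b := by
  ext i j
  rw [leviSnd_apply, ← splitEquiv_inr h, ← splitEquiv_inr h]
  simp [blockDiag]

lemma leviFst_surjective {m : ℕ} (h : m ≤ n) :
    Function.Surjective (leviFst (F := F) h) :=
  fun a => ⟨⟨blockDiag h a 1, blockDiag_mem h a 1⟩, leviFst_blockDiag h a 1⟩

lemma leviSnd_surjective {m : ℕ} (h : m ≤ n) :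
    Function.Surjective (leviSnd (F := F) h) :=
  fun b => ⟨⟨blockDiag h 1 b, blockDiag_mem h 1 b⟩, leviSnd_blockDiag h 1 b⟩

lemma blockDiag_conj {m : ℕ} (h : m ≤ n) (y : GL (Fin m) F) (g : GL (Fin n) F) :
    ((blockDiag h y 1)⁻¹ * g * blockDiag h y 1).val =
      Matrix.reindex (splitEquiv h) (splitEquiv h) (Matrix.fromBlocks
        ((y⁻¹).val * g.val.submatrix (Fin.castLE h) (Fin.castLE h) * y.val)
        ((y⁻¹).val * g.val.submatrix (Fin.castLE h) (fun j : Fin (n - m) => ⟨m + j, by omega⟩))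
        (g.val.submatrix (fun j : Fin (n - m) => ⟨m + j, by omega⟩) (Fin.castLE h) * y.val)
        (g.val.submatrix (fun j : Fin (n - m) => ⟨m + j, by omega⟩)
          (fun j : Fin (n - m) => ⟨m + j, by omega⟩))) := by
  have hg : g.val = Matrix.reindex (splitEquiv h) (splitEquiv h) (Matrix.fromBlocks
      (g.val.submatrix (Fin.castLE h) (Fin.castLE h))
      (g.val.submatrix (Fin.castLE h) (fun j : Fin (n - m) => ⟨m + j, by omega⟩))
      (g.val.submatrix (fun j : Fin (n - m) => ⟨m + j, by omega⟩) (Fin.castLE h))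
      (g.val.submatrix (fun j : Fin (n - m) => ⟨m + j, by omega⟩)
        (fun j : Fin (n - m) => ⟨m + j, by omega⟩))) := by
    ext i j
    obtain ⟨i, rfl⟩ := (splitEquiv h).surjective i
    obtain ⟨j, rfl⟩ := (splitEquiv h).surjective j
    rcases i with i | i <;> rcases j with j | j <;>
      simp only [Matrix.reindex_apply, Matrix.submatrix_apply, Equiv.symm_apply_apply,
        Matrix.fromBlocks_apply₁₁, Matrix.fromBlocks_apply₁₂, Matrix.fromBlocks_apply₂₁,
        Matrix.fromBlocks_apply₂₂] <;>
      simp only [splitEquiv_inl, splitEquiv_inr]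
  have h1 : ((blockDiag h y 1)⁻¹).val = Matrix.reindex (splitEquiv h) (splitEquiv h)
    (Matrix.fromBlocks (y⁻¹).val 0 0 1) := by
    change (blockDiag h y 1).inv = _
    simp [blockDiag]
  have h2 : (blockDiag h y 1).val = Matrix.reindex (splitEquiv h) (splitEquiv h)
    (Matrix.fromBlocks y.val 0 0 1) := by
    simp [blockDiag]
  rw [Units.val_mul, Units.val_mul, h1, h2]
  conv_lhs => rw [hg]
  simp only [Matrix.reindex_apply, Matrix.submatrix_mul_equiv, Matrix.fromBlocks_multiply]
  simp

/-- For `d ≤ m`, an element of `P_m` lies in `P_d` if and only if its upper left block does. -/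
lemma leviFst_mem_parabolic {m d : ℕ} (h : m ≤ n) (hd : d ≤ m) (p : parabolic F n m) :
    leviFst h p ∈ parabolic F m d ↔ (p : GL (Fin n) F) ∈ parabolic F n d := by
  constructor
  · intro hp i j hj hi
    by_cases him : (i : ℕ) < m
    · exact hp ⟨i, him⟩ ⟨j, by omega⟩ hj hi
    · exact p.2 i j (by omega) (by omega)
  · intro hp i j hj hi
    exact hp _ _ hj hi

end Parabolic

section Steinberg

variable {F : Type*} [Field F] [Fintype F] [DecidableEq F] {n : ℕ}

lemma steinberg_apply (g : GL (Fin n) F) :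
    steinberg F n g = ∑ J ∈ (Finset.Ico 1 n).powerset,
      (-1 : ℂ) ^ J.card * induced (parabolicJ F n J) (fun _ => 1) g := by
  simp [steinberg, Finset.sum_apply]

lemma steinberg_conj (g y : GL (Fin n) F) : steinberg F n (y⁻¹ * g * y) = steinberg F n g := by
  simp only [steinberg_apply, induced_conj]

/-- The subgroups `P_J` of `GL(m, F)` pull back to the subgroups `P_{J'}` of `GL(n, F)` for which
the largest element of the complement of `J'` is `m`, or for which `J'` is everything if `m = 0`. -/
lemma induced_steinberg_leviFst {m : ℕ} (h : m < n) (g : GL (Fin n) F) :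
    induced (parabolic F n m) (fun p => steinberg F m (leviFst h.le p)) g =
      ∑ J ∈ (Finset.Ico 1 m).powerset, (-1 : ℂ) ^ J.card *
        induced (parabolicJ F n (J ∪ Finset.Ico (m + 1) n)) (fun _ => 1) g := by
  simp only [steinberg_apply]
  rw [induced_finset_sum]
  refine Finset.sum_congr rfl fun J hJ => ?_
  rw [induced_const_mul]
  congr 1
  have hle : parabolicJ F n (J ∪ Finset.Ico (m + 1) n) ≤ parabolic F n m := by
    intro x hx
    rcases Nat.eq_zero_or_pos m with rfl | hm
    · rw [parabolic_zero]; trivial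
    · refine mem_parabolicJ.1 hx m hm h fun hmem => ?_
      have hJ := Finset.mem_powerset.1 hJ
      rcases Finset.mem_union.1 hmem with h1 | h1
      · have := Finset.mem_Ico.1 (hJ h1); omega
      · have := Finset.mem_Ico.1 h1; omega
  have key := induced_mul_inflated_induced (leviFst (F := F) h.le) (leviFst_surjective h.le)
    (parabolicJ F m J) (fun _ => 1) (fun _ => 1) (fun _ _ => rfl)
    (parabolicJ F n (J ∪ Finset.Ico (m + 1) n)) hle ?_ g
  · simpa using key
  · intro p
    rw [mem_parabolicJ, mem_parabolicJ]
    constructor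
    · intro hp d h1 h2 h3
      rw [leviFst_mem_parabolic _ h2.le]
      refine hp d h1 (by omega) ?_
      simp only [Finset.mem_union, Finset.mem_Ico, not_or]
      exact ⟨h3, by omega⟩
    · intro hp d h1 h2 h3
      simp only [Finset.mem_union, Finset.mem_Ico, not_or] at h3
      have hdm : d ≤ m := by omega
      rcases hdm.eq_or_lt with rfl | hdm
      · exact p.2
      · rw [← leviFst_mem_parabolic h.le hdm.le]
        exact hp d h1 hdm h3.1

/-- Sorting the subsets `J` of `{1, …, n - 1}` by the largest element `m` of the complement of
`J`, or `m = 0` when there is none, gives a recursion for the Steinberg character. -/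
theorem steinberg_recursion (hn : 1 ≤ n) (g : GL (Fin n) F) :
    steinberg F n g = ∑ m : Fin n, (-1 : ℂ) ^ (n - 1 - m : ℕ) *
      induced (parabolic F n m) (fun p => steinberg F m (leviFst m.2.le p)) g := by
  simp only [fun m : Fin n => induced_steinberg_leviFst m.2 g]
  simp only [Finset.mul_sum]
  rw [Finset.sum_sigma', steinberg_apply]
  symm
  refine Finset.sum_bij (fun x _ => x.2 ∪ Finset.Ico (x.1 + 1 : ℕ) n) ?_ ?_ ?_ ?_
  · rintro ⟨m, J⟩ hJ
    simp only [Finset.mem_sigma, Finset.mem_univ, true_and, Finset.mem_powerset] at hJ ⊢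
    intro d hd
    rcases Finset.mem_union.1 hd with h1 | h1
    · have := Finset.mem_Ico.1 (hJ h1)
      rw [Finset.mem_Ico]; omega
    · have := Finset.mem_Ico.1 h1
      rw [Finset.mem_Ico]; omega
  · have hlt : ∀ (m m' : Fin n) (J J' : Finset ℕ), J' ⊆ Finset.Ico 1 (m' : ℕ) →
        J ∪ Finset.Ico (m + 1 : ℕ) n = J' ∪ Finset.Ico (m' + 1 : ℕ) n → ¬ (m : ℕ) < m' := by
      intro m m' J J' hJ' he hlt
      have h1 : (m' : ℕ) ∈ J ∪ Finset.Ico (m + 1 : ℕ) n :=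
        Finset.mem_union_right _ (Finset.mem_Ico.2 ⟨hlt, m'.2⟩)
      rw [he] at h1
      rcases Finset.mem_union.1 h1 with h1 | h1
      · have := Finset.mem_Ico.1 (hJ' h1); omega
      · have := Finset.mem_Ico.1 h1; omega
    rintro ⟨m, J⟩ hJ ⟨m', J'⟩ hJ' he
    simp only [Finset.mem_sigma, Finset.mem_univ, true_and, Finset.mem_powerset] at hJ hJ' he
    have hm : m = m' := by
      apply Fin.ext
      have h1 := hlt m m' J J' hJ' he
      have h2 := hlt m' m J' J hJ he.symm
      omega
    subst hm
    have : J = J' := by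
      ext d
      have := Finset.ext_iff.1 he d
      simp only [Finset.mem_union, Finset.mem_Ico] at this
      constructor
      · intro hd
        have := Finset.mem_Ico.1 (hJ hd)
        rcases ‹(_ ∨ _) ↔ _›.1 (Or.inl hd) with h | h
        · exact h
        · omega
      · intro hd
        have := Finset.mem_Ico.1 (hJ' hd)
        rcases ‹(_ ∨ _) ↔ _›.2 (Or.inl hd) with h | h
        · exact h
        · omega
    rw [this]
  · intro J hJ
    rw [Finset.mem_powerset] at hJ
    -- Adjoining `0` to the complement of `J` covers the case `J = {1, …, n - 1}`.
    set S := insert 0 (Finset.Ico 1 n \ J) with hS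
    have hne : S.Nonempty := ⟨0, Finset.mem_insert_self _ _⟩
    set m := S.max' hne with hm
    have hmS : m ∈ S := S.max'_mem hne
    have hmn : m < n := by
      rcases Finset.mem_insert.1 hmS with h | h
      · omega
      · have := Finset.mem_Ico.1 (Finset.mem_sdiff.1 h).1; omega
    have hmax : ∀ d, 1 ≤ d → d < n → d ∉ J → d ≤ m := fun d h1 h2 h3 =>
      S.le_max' d (Finset.mem_insert_of_mem (Finset.mem_sdiff.2 ⟨Finset.mem_Ico.2 ⟨h1, h2⟩, h3⟩))
    have hmJ : m ∉ J := by
      intro h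
      rcases Finset.mem_insert.1 hmS with h1 | h1
      · have := Finset.mem_Ico.1 (hJ h); omega
      · exact (Finset.mem_sdiff.1 h1).2 h
    refine ⟨⟨⟨m, hmn⟩, J.filter (· < m)⟩, ?_, ?_⟩
    · simp only [Finset.mem_sigma, Finset.mem_univ, true_and, Finset.mem_powerset]
      intro d hd
      obtain ⟨h1, h2⟩ := Finset.mem_filter.1 hd
      exact Finset.mem_Ico.2 ⟨(Finset.mem_Ico.1 (hJ h1)).1, h2⟩
    · ext d
      simp only [Finset.mem_union, Finset.mem_filter, Finset.mem_Ico]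
      constructor
      · rintro (h | h)
        · exact h.1
        · by_contra hd
          have := hmax d (by omega) h.2 hd
          omega
      · intro hd
        have h1 := Finset.mem_Ico.1 (hJ hd)
        rcases lt_trichotomy d m with h | h | h
        · exact Or.inl ⟨hd, h⟩
        · exact absurd (h ▸ hd) hmJ
        · exact Or.inr ⟨h, h1.2⟩
  · rintro ⟨m, J⟩ hJ
    simp only [Finset.mem_sigma, Finset.mem_univ, true_and, Finset.mem_powerset] at hJ
    have hd : Disjoint J (Finset.Ico (m + 1 : ℕ) n) := by
      rw [Finset.disjoint_left]
      intro d h1 h2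
      have := Finset.mem_Ico.1 (hJ h1)
      have := Finset.mem_Ico.1 h2
      omega
    dsimp only
    rw [Finset.card_union_of_disjoint hd, Nat.card_Ico, ← mul_assoc, ← pow_add]
    congr 2
    omega

end Steinberg

/-! ### The Steinberg character and invariant subspaces -/

section StandardSubspace

variable {F : Type*} [Field F] {n : ℕ}

/-- The span of the first `m` standard basis vectors of `F^n`. -/
def stdSubspace (F : Type*) [Field F] (n m : ℕ) : Submodule F (Fin n → F) where
  carrier := {v | ∀ i : Fin n, m ≤ (i : ℕ) → v i = 0}
  add_mem' := by
    intro v w hv hw i hi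
    simp [hv i hi, hw i hi]
  zero_mem' := fun _ _ => rfl
  smul_mem' := by
    intro c v hv i hi
    simp [hv i hi]

/-- Extension by zero identifies `F^m` with the standard subspace of dimension `m`. -/
def stdSubspaceEquiv {m : ℕ} (h : m ≤ n) : (Fin m → F) ≃ₗ[F] stdSubspace F n m where
  toFun w := ⟨fun i => if hi : (i : ℕ) < m then w ⟨i, hi⟩ else 0, fun i hi => by
    simp [not_lt.2 hi]⟩
  invFun v i := v.1 (Fin.castLE h i)
  map_add' := by
    intro v w
    ext i
    by_cases hi : (i : ℕ) < m <;> simp [hi]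
  map_smul' := by
    intro c v
    ext i
    by_cases hi : (i : ℕ) < m <;> simp [hi]
  left_inv := by
    intro w
    ext i
    simp
  right_inv := by
    rintro ⟨v, hv⟩
    ext i
    by_cases hi : (i : ℕ) < m
    · simp [hi]
    · simp [hi, hv i (not_lt.1 hi)]

lemma mulVec_apply_of_mem_stdSubspace {m : ℕ} (h : m ≤ n) (A : Matrix (Fin n) (Fin n) F)
    {v : Fin n → F} (hv : v ∈ stdSubspace F n m) (i : Fin n) :
    (A *ᵥ v) i = ∑ j : Fin m, A i (Fin.castLE h j) * v (Fin.castLE h j) := by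
  simp only [Matrix.mulVec, dotProduct]
  symm
  refine Finset.sum_of_injOn (Fin.castLE h) (Fin.castLE_injective h).injOn (by simp) ?_ (by simp)
  intro k _ hk
  have hk' : m ≤ (k : ℕ) := by
    by_contra hlt
    exact hk ⟨⟨k, by omega⟩, by simp, by ext; simp⟩
  rw [hv k hk', mul_zero]

lemma mem_parabolic_iff_stdSubspace {m : ℕ} (h : m ≤ n) (g : GL (Fin n) F) :
    g ∈ parabolic F n m ↔ ∀ v ∈ stdSubspace F n m, g.val *ᵥ v ∈ stdSubspace F n m := by
  constructor
  · intro hg v hv i hi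
    rw [mulVec_apply_of_mem_stdSubspace h _ hv]
    exact Finset.sum_eq_zero fun j _ => by rw [hg i _ (by simp) hi, zero_mul]
  · intro hg i j hj hi
    have := hg (Pi.single j 1) (fun k hk => by
      rw [Pi.single_apply, if_neg]; rintro rfl; omega) i hi
    simpa using this

lemma mem_parabolic_iff_stdSubspace' {m : ℕ} (h : m ≤ n) (g : GL (Fin n) F) :
    g ∈ parabolic F n m ↔ ∀ v, g.val *ᵥ v ∈ stdSubspace F n m ↔ v ∈ stdSubspace F n m := by
  constructor
  · intro hg v
    refine ⟨fun hv => ?_, (mem_parabolic_iff_stdSubspace h g).1 hg v⟩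
    have := (mem_parabolic_iff_stdSubspace h g⁻¹).1 (inv_mem hg) _ hv
    simpa [Matrix.mulVec_mulVec, ← Units.val_mul, -Matrix.coe_units_inv] using this
  · intro hg
    exact (mem_parabolic_iff_stdSubspace h g).2 fun v hv => (hg v).2 hv

/-- The translate by `x` of the standard subspace of dimension `m`. -/
def translate (m : ℕ) (x : GL (Fin n) F) : Submodule F (Fin n → F) :=
  (stdSubspace F n m).comap (Matrix.toLin' (x⁻¹).val)

lemma mem_translate {m : ℕ} {x : GL (Fin n) F} {v : Fin n → F} :
    v ∈ translate m x ↔ (x⁻¹).val *ᵥ v ∈ stdSubspace F n m := Iff.rfl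

lemma inv_mulVec_mulVec (x : GL (Fin n) F) (v : Fin n → F) :
    (x⁻¹).val *ᵥ (x.val *ᵥ v) = v := by
  rw [Matrix.mulVec_mulVec, ← Units.val_mul]; simp

lemma mulVec_inv_mulVec (x : GL (Fin n) F) (v : Fin n → F) :
    x.val *ᵥ ((x⁻¹).val *ᵥ v) = v := by
  rw [Matrix.mulVec_mulVec, ← Units.val_mul]; simp

/-- The parametrization of `translate m x` by `F^m`. -/
def translateEquiv {m : ℕ} (h : m ≤ n) (x : GL (Fin n) F) : (Fin m → F) ≃ₗ[F] translate m x :=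
  (stdSubspaceEquiv h).trans
    { toFun := fun v => ⟨x.val *ᵥ v.1, by rw [mem_translate, inv_mulVec_mulVec]; exact v.2⟩
      invFun := fun v => ⟨(x⁻¹).val *ᵥ v.1, v.2⟩
      map_add' := fun v w => by ext; simp [Matrix.mulVec_add]
      map_smul' := fun c v => by ext; simp [Matrix.mulVec_smul]
      left_inv := fun v => Subtype.ext (inv_mulVec_mulVec x v.1)
      right_inv := fun v => Subtype.ext (mulVec_inv_mulVec x v.1) }

lemma finrank_translate {m : ℕ} (h : m ≤ n) (x : GL (Fin n) F) :
    Module.finrank F (translate m x) = m := by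
  rw [← (translateEquiv h x).finrank_eq]; simp

lemma finrank_stdSubspace {m : ℕ} (h : m ≤ n) : Module.finrank F (stdSubspace F n m) = m := by
  rw [← (stdSubspaceEquiv h).finrank_eq]; simp

lemma translate_eq_translate_iff {m : ℕ} (h : m ≤ n) (x y : GL (Fin n) F) :
    translate m x = translate m y ↔ x⁻¹ * y ∈ parabolic F n m := by
  rw [mem_parabolic_iff_stdSubspace' h, Submodule.ext_iff]
  simp only [mem_translate]
  constructor
  · intro H v
    have := H (y.val *ᵥ v)
    rw [inv_mulVec_mulVec] at this
    rwa [Units.val_mul, ← Matrix.mulVec_mulVec]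
  · intro H v
    have := H ((y⁻¹).val *ᵥ v)
    rwa [Units.val_mul, ← Matrix.mulVec_mulVec, mulVec_inv_mulVec] at this

lemma exists_translate_eq {m : ℕ} (h : m ≤ n) (X : Submodule F (Fin n → F))
    (hX : Module.finrank F X = m) : ∃ x : GL (Fin n) F, translate m x = X := by
  obtain ⟨X', hX'⟩ := X.exists_isCompl
  obtain ⟨E', hE'⟩ := (stdSubspace F n m).exists_isCompl
  have h1 := Submodule.finrank_add_eq_of_isCompl hX'
  have h2 := Submodule.finrank_add_eq_of_isCompl hE'
  rw [finrank_stdSubspace h] at h2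
  let a : X ≃ₗ[F] stdSubspace F n m :=
    LinearEquiv.ofFinrankEq _ _ (by rw [hX, finrank_stdSubspace h])
  let b : X' ≃ₗ[F] E' := LinearEquiv.ofFinrankEq _ _ (by omega)
  let L : (Fin n → F) ≃ₗ[F] (Fin n → F) :=
    (Submodule.prodEquivOfIsCompl _ _ hX').symm.trans
      ((a.prodCongr b).trans (Submodule.prodEquivOfIsCompl _ _ hE'))
  have hL : ∀ v, L v ∈ stdSubspace F n m ↔ v ∈ X := by
    intro v
    obtain ⟨⟨u, w⟩, rfl⟩ := (Submodule.prodEquivOfIsCompl _ _ hX').surjective v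
    have h3 : L (Submodule.prodEquivOfIsCompl X X' hX' (u, w)) =
        Submodule.prodEquivOfIsCompl _ _ hE' (a u, b w) := by
      simp [L, -Submodule.coe_prodEquivOfIsCompl']
    rw [h3, Submodule.coe_prodEquivOfIsCompl', Submodule.coe_prodEquivOfIsCompl',
      Submodule.add_mem_iff_right _ (a u).2, Submodule.add_mem_iff_right _ u.2]
    constructor
    · intro h4
      have : b w = 0 := by
        apply Subtype.ext
        exact (Submodule.disjoint_def.1 hE'.disjoint) _ h4 (b w).2
      rw [LinearEquiv.map_eq_zero_iff] at this
      simp [this]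
    · intro h4
      have : w = 0 := by
        apply Subtype.ext
        exact (Submodule.disjoint_def.1 hX'.disjoint) _ h4 w.2
      simp [this]
  let M : GL (Fin n) F := ⟨LinearMap.toMatrix' L, LinearMap.toMatrix' L.symm,
    by rw [← LinearMap.toMatrix'_comp]; simp, by rw [← LinearMap.toMatrix'_comp]; simp⟩
  refine ⟨M⁻¹, ?_⟩
  ext v
  rw [mem_translate, inv_inv, ← hL]
  have : M.val *ᵥ v = L v := by
    simp [M, LinearMap.toMatrix'_mulVec]
  rw [this]

lemma translate_mem_invtSubmodule_iff {m : ℕ} (h : m ≤ n) (g x : GL (Fin n) F) :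
    translate m x ∈ Module.End.invtSubmodule (Matrix.toLin' g.val) ↔
      x⁻¹ * g * x ∈ parabolic F n m := by
  rw [mem_parabolic_iff_stdSubspace h, Module.End.mem_invtSubmodule_iff_forall_mem_of_mem]
  simp only [mem_translate, Matrix.toLin'_apply, Units.val_mul, ← Matrix.mulVec_mulVec]
  constructor
  · intro H v hv
    refine H (x.val *ᵥ v) ?_
    rwa [inv_mulVec_mulVec]
  · intro H v hv
    have := H _ hv
    rwa [mulVec_inv_mulVec] at this

variable [Finite F]

/-- The restriction of `g` to the translate by `x` is given by the upper left block of
`x⁻¹ g x`. -/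
lemma steinbergOn_translate {m : ℕ} (h : m ≤ n) (g x : GL (Fin n) F)
    (hx : x⁻¹ * g * x ∈ parabolic F n m) :
    steinbergOn (Matrix.toLin' g.val) (translate m x) =
      steinbergEnd (Matrix.toLin' (leviFst h ⟨x⁻¹ * g * x, hx⟩).val) := by
  rw [steinbergOn, dif_pos ((translate_mem_invtSubmodule_iff h g x).2 hx)]
  symm
  refine steinbergEnd_conj (translateEquiv h x) _ _ fun w => ?_
  apply Subtype.ext
  change x.val *ᵥ (stdSubspaceEquiv h _).1 = g.val *ᵥ (x.val *ᵥ (stdSubspaceEquiv h w).1)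
  have key : (stdSubspaceEquiv h
      (Matrix.toLin' (leviFst h ⟨x⁻¹ * g * x, hx⟩).val w)).1 =
      (x⁻¹ * g * x).val *ᵥ (stdSubspaceEquiv h w).1 := by
    ext i
    by_cases hi : (i : ℕ) < m
    · rw [mulVec_apply_of_mem_stdSubspace h _ (stdSubspaceEquiv h w).2]
      simp [stdSubspaceEquiv, hi, Matrix.mulVec, dotProduct, -Units.val_mul]
    · rw [(mem_parabolic_iff_stdSubspace h _).1 hx _ (stdSubspaceEquiv h w).2 i (not_lt.1 hi)]
      simp [stdSubspaceEquiv, hi]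
  rw [key, Units.val_mul, Units.val_mul, ← Matrix.mulVec_mulVec, ← Matrix.mulVec_mulVec,
    mulVec_inv_mulVec]

end StandardSubspace

section SteinbergValue

variable {F : Type*} [Field F] [Fintype F] [DecidableEq F] {n : ℕ}

open Classical in
/-- As `GL(n, F)` permutes the subspaces of dimension `m` transitively, inducing from `P_m` is
summing over these subspaces, and only the invariant ones contribute. -/
lemma induced_steinbergEnd_leviFst {m : ℕ} (h : m ≤ n) (g : GL (Fin n) F)
    [Fintype (Submodule F (Fin n → F))] :
    induced (parabolic F n m)
      (fun p => steinbergEnd (Matrix.toLin' (leviFst h p).val)) g =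
      ∑ X ∈ Finset.univ.filter (fun X : Submodule F (Fin n → F) => Module.finrank F X = m),
        steinbergOn (Matrix.toLin' g.val) X := by
  have h1 : ∀ x : GL (Fin n) F, (if hx : x⁻¹ * g * x ∈ parabolic F n m then
      steinbergEnd (Matrix.toLin' (leviFst h ⟨x⁻¹ * g * x, hx⟩).val) else 0) =
      steinbergOn (Matrix.toLin' g.val) (translate m x) := by
    intro x
    split_ifs with hx
    · rw [steinbergOn_translate h g x hx]
    · rw [steinbergOn, dif_neg]
      rwa [translate_mem_invtSubmodule_iff h]
  rw [induced_apply, Finset.sum_congr rfl fun x _ => h1 x,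
    sum_comp_eq_card_mul_sum (Ω := {X : Submodule F (Fin n → F) // Module.finrank F X = m})
      (parabolic F n m) (fun x => ⟨translate m x, finrank_translate h x⟩)
      (fun X => (exists_translate_eq h X.1 X.2).imp fun x hx => Subtype.ext hx)
      (fun x y => by rw [Subtype.mk_eq_mk, translate_eq_translate_iff h])
      (fun X => steinbergOn (Matrix.toLin' g.val) X.1),
    inv_mul_cancel_left₀ (natCast_card_ne_zero _)]
  symm
  refine Finset.sum_subtype _ (fun X => by simp) _

/-- The Steinberg character satisfies the recursion of the Möbius function, hence it is the
signed Möbius number of the lattice of invariant subspaces. -/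
theorem steinberg_eq_steinbergEnd (n : ℕ) (g : GL (Fin n) F) :
    steinberg F n g = steinbergEnd (Matrix.toLin' g.val) := by
  classical
  induction n using Nat.strong_induction_on with
  | _ n ih =>
    rcases Nat.eq_zero_or_pos n with rfl | hn
    · have h1 : steinberg F 0 g = 1 := by
        have : parabolicJ F 0 ∅ = ⊤ := by
          ext x
          simp [mem_parabolicJ]
        have h0 : ∀ H : Subgroup (GL (Fin 0) F), H = ⊤ → induced H (fun _ => 1) g = 1 := by
          rintro _ rfl
          exact induced_top (fun _ => (1 : ℂ)) (fun _ _ => rfl) g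
        rw [steinberg_apply]
        simpa using h0 _ this
      have h2 : (⊥ : Module.End.invtSubmodule (Matrix.toLin' g.val)) = ⊤ :=
        Subtype.ext (Subsingleton.elim _ _)
      have := Fintype.ofFinite (Module.End.invtSubmodule (Matrix.toLin' g.val))
      have h3 := sum_moebius_right (⊥ : Module.End.invtSubmodule (Matrix.toLin' g.val)) ⊤
      rw [if_pos h2, Finset.sum_eq_single ⊤ (fun b _ hb => by
          exact absurd (Subtype.ext (Subsingleton.elim _ _)) hb) (by simp)] at h3
      rw [h1, steinbergEnd, h3]
      simp
    · have := Fintype.ofFinite (Submodule F (Fin n → F))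
      have : Nonempty (Fin n) := ⟨⟨0, hn⟩⟩
      rw [steinberg_recursion hn]
      have h1 : ∀ m : Fin n, induced (parabolic F n m)
          (fun p => steinberg F m (leviFst m.2.le p)) g =
          ∑ X ∈ Finset.univ.filter (fun X : Submodule F (Fin n → F) => Module.finrank F X = m),
            steinbergOn (Matrix.toLin' g.val) X := by
        intro m
        simp only [fun p => ih m m.2 (leviFst m.2.le p)]
        exact induced_steinbergEnd_leviFst m.2.le g
      simp only [h1]
      have h2 := sum_steinbergOn (Matrix.toLin' g.val)
      have hle : ∀ X : Submodule F (Fin n → F), Module.finrank F X < n + 1 := fun X =>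
        Nat.lt_succ_of_le (by simpa using Submodule.finrank_le X)
      rw [← Finset.sum_fiberwise Finset.univ
        (fun X : Submodule F (Fin n → F) => (⟨Module.finrank F X, hle X⟩ : Fin (n + 1))),
        Fin.sum_univ_castSucc] at h2
      have h3 : ∀ m : Fin (n + 1), (∑ X ∈ Finset.univ.filter (fun X : Submodule F (Fin n → F) =>
          (⟨Module.finrank F X, hle X⟩ : Fin (n + 1)) = m),
          (-1) ^ Module.finrank F X * steinbergOn (Matrix.toLin' g.val) X) =
          (-1) ^ (m : ℕ) * ∑ X ∈ Finset.univ.filter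
            (fun X : Submodule F (Fin n → F) => Module.finrank F X = m),
            steinbergOn (Matrix.toLin' g.val) X := by
        intro m
        rw [Finset.mul_sum]
        refine Finset.sum_congr (by simp [Fin.ext_iff]) fun X hX => ?_
        rw [(Finset.mem_filter.1 hX).2]
      have h4 : (Finset.univ.filter fun X : Submodule F (Fin n → F) =>
          Module.finrank F X = (Fin.last n : ℕ)) = {⊤} := by
        ext X
        simp only [Finset.mem_filter, Finset.mem_univ, true_and, Finset.mem_singleton,
          Fin.val_last]
        constructor
        · intro hX
          exact Submodule.eq_top_of_finrank_eq (by simpa using hX)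
        · rintro rfl
          simp
      simp only [h3] at h2
      rw [h4, Finset.sum_singleton, steinbergOn_top] at h2
      have h5 : ∀ m : Fin n, (-1 : ℂ) ^ (n - 1 - m : ℕ) = -((-1) ^ n * (-1) ^ (m : ℕ)) := by
        intro m
        have h6 : ∀ k l : ℕ, (-1 : ℂ) ^ k = -((-1) ^ (k + l + 1) * (-1) ^ l) := by
          intro k l
          rw [pow_succ, mul_neg_one, neg_mul, neg_neg, pow_add, mul_assoc, ← mul_pow]
          simp
        have h7 := h6 (n - 1 - m) m
        rwa [show (n - 1 - m + m + 1 : ℕ) = n by omega] at h7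
      have h6 : ((-1 : ℂ) ^ n) * (-1) ^ n = 1 := by rw [← mul_pow]; simp
      simp only [h5, neg_mul, mul_assoc, Finset.sum_neg_distrib, ← Finset.mul_sum]
      simp only [Fin.val_castSucc, Fin.val_last] at h2
      linear_combination (-(-1 : ℂ) ^ n) * h2 + steinbergEnd (Matrix.toLin' g.val) * h6

end SteinbergValue

/-! ### Fixed points of affine maps and additive characters -/

section Fourier

variable {F : Type*} [Field F] [Fintype F] [DecidableEq F]

lemma sum_addChar_dotProduct (ν : AddChar F ℂ) (hν : ν ≠ 1) {k : ℕ} (u : Fin k → F) :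
    ∑ w : Fin k → F, ν (u ⬝ᵥ w) = if u = 0 then (Fintype.card (Fin k → F) : ℂ) else 0 := by
  classical
  let f : (Fin k → F) →+ F :=
    { toFun := fun w => u ⬝ᵥ w
      map_zero' := dotProduct_zero u
      map_add' := dotProduct_add u }
  have h := AddChar.sum_eq_ite (ν.compAddMonoidHom f)
  have h0 : ν.compAddMonoidHom f = 0 ↔ u = 0 := by
    constructor
    · intro h0
      by_contra hu
      obtain ⟨i, hi⟩ := Function.ne_iff.1 hu
      apply hν
      ext c
      have h1 := DFunLike.congr_fun h0 (Pi.single i ((u i)⁻¹ * c))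
      have h2 : f (Pi.single i ((u i)⁻¹ * c)) = c := by
        change u ⬝ᵥ Pi.single i ((u i)⁻¹ * c) = c
        rw [dotProduct_single, mul_inv_cancel_left₀ hi]
      rw [AddChar.compAddMonoidHom_apply, h2] at h1
      simpa using h1
    · rintro rfl
      ext w
      simp [f]
  simp only [h0] at h
  exact h

/-- The fixed points of `w ↦ a w + v` are counted by the row vectors fixed by `a`, by
orthogonality of the additive characters of `F^k`. -/
lemma card_affine_fixed (ν : AddChar F ℂ) (hν : ν ≠ 1) {k : ℕ} (a : Matrix (Fin k) (Fin k) F)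
    (v : Fin k → F) :
    (Nat.card {w : Fin k → F // a *ᵥ w + v = w} : ℂ) =
      ∑ φ : Fin k → F, if φ ᵥ* a = φ then ν (φ ⬝ᵥ v) else 0 := by
  set q : ℂ := (Fintype.card (Fin k → F) : ℂ) with hq
  have hq0 : q ≠ 0 := by rw [hq]; exact_mod_cast Fintype.card_ne_zero
  have h1 : q * (Nat.card {w : Fin k → F // a *ᵥ w + v = w} : ℂ) =
      ∑ w : Fin k → F, ∑ φ : Fin k → F, ν ((a *ᵥ w + v - w) ⬝ᵥ φ) := by
    simp only [sum_addChar_dotProduct ν hν, sub_eq_zero]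
    rw [← Finset.sum_filter, Finset.sum_const, nsmul_eq_mul, Nat.card_eq_fintype_card,
      Fintype.card_subtype, mul_comm]
  have h2 : ∀ w φ : Fin k → F, ν ((a *ᵥ w + v - w) ⬝ᵥ φ) =
      ν (φ ⬝ᵥ v) * ν ((φ ᵥ* a - φ) ⬝ᵥ w) := by
    intro w φ
    rw [← AddChar.map_add_eq_mul]
    congr 1
    rw [dotProduct_comm, dotProduct_sub, dotProduct_add, dotProduct_mulVec, sub_dotProduct]
    ring
  have h3 : ∑ w : Fin k → F, ∑ φ : Fin k → F, ν ((a *ᵥ w + v - w) ⬝ᵥ φ) =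
      q * ∑ φ : Fin k → F, if φ ᵥ* a = φ then ν (φ ⬝ᵥ v) else 0 := by
    rw [Finset.sum_comm, Finset.mul_sum]
    refine Finset.sum_congr rfl fun φ _ => ?_
    simp only [h2, ← Finset.mul_sum, sum_addChar_dotProduct ν hν, sub_eq_zero]
    split_ifs <;> simp [mul_comm, hq]
  exact mul_left_cancel₀ hq0 (h1.trans h3)

end Fourier

/-! ### The subgroups of a parabolic with unipotent lower block -/

section LeviUnipotent

variable {F : Type*} [Field F] {n : ℕ}

/-- The subgroup of the parabolic `P_m` formed by the matrices whose lower right block is upper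
triangular unipotent, the upper left block being arbitrary. -/
def leviUnipotent (F : Type*) [Field F] {n m : ℕ} (h : m ≤ n) : Subgroup (GL (Fin n) F) :=
  ((unipotent F (n - m)).comap (leviSnd h)).map (parabolic F n m).subtype

lemma leviUnipotent_le {m : ℕ} (h : m ≤ n) : leviUnipotent F h ≤ parabolic F n m := by
  rintro _ ⟨p, -, rfl⟩
  exact p.2

lemma coe_mem_leviUnipotent {m : ℕ} (h : m ≤ n) (p : parabolic F n m) :
    (p : GL (Fin n) F) ∈ leviUnipotent F h ↔ leviSnd h p ∈ unipotent F (n - m) := by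
  constructor
  · rintro ⟨p', hp', he⟩
    rwa [← Subtype.ext he]
  · intro hp
    exact ⟨p, hp, rfl⟩

lemma mem_leviUnipotent {m : ℕ} (h : m ≤ n) {g : GL (Fin n) F} :
    g ∈ leviUnipotent F h ↔
      ∀ i : Fin n, m ≤ (i : ℕ) → g.val i i = 1 ∧ ∀ j < i, g.val i j = 0 := by
  constructor
  · intro hg
    have hp := leviUnipotent_le h hg
    obtain ⟨h1, h2⟩ := (coe_mem_leviUnipotent h ⟨g, hp⟩).1 hg
    have hlt : ∀ i : Fin (n - m), m + (i : ℕ) < n := fun i => by omega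
    intro i hi
    obtain ⟨i, rfl⟩ : ∃ i' : Fin (n - m), (⟨m + i', hlt i'⟩ : Fin n) = i :=
      ⟨⟨i - m, by omega⟩, by ext; simp; omega⟩
    refine ⟨h1 i, fun j hj => ?_⟩
    by_cases hjm : (j : ℕ) < m
    · exact hp _ j hjm hi
    · obtain ⟨j, rfl⟩ : ∃ j' : Fin (n - m), (⟨m + j', hlt j'⟩ : Fin n) = j :=
        ⟨⟨j - m, by omega⟩, by ext; simp; omega⟩
      exact h2 i j (Fin.lt_def.2 (Nat.lt_of_add_lt_add_left hj))
  · intro hg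
    have hp : g ∈ parabolic F n m := fun i j hj hi => (hg i hi).2 j (Fin.lt_def.2 (by omega))
    refine (coe_mem_leviUnipotent h ⟨g, hp⟩).2
      ⟨fun i => (hg ⟨m + i, by omega⟩ (Nat.le_add_right _ _)).1, fun i j hij => ?_⟩
    exact (hg ⟨m + i, by omega⟩ (Nat.le_add_right _ _)).2 ⟨m + j, by omega⟩
      (Fin.lt_def.2 (Nat.add_lt_add_left hij m))

/-- When the unipotent block has size `1`, the subgroup is given by its last row, and so it is the
stabilizer of a row vector. -/
lemma mem_leviUnipotent_last {m : ℕ} {g : GL (Fin (m + 1)) F} :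
    g ∈ leviUnipotent F (Nat.le_succ m) ↔
      ∀ j, g.val (Fin.last m) j = if j = Fin.last m then 1 else 0 := by
  rw [mem_leviUnipotent]
  constructor
  · intro hg j
    obtain ⟨h1, h2⟩ := hg (Fin.last m) (by simp)
    split_ifs with hj
    · rw [hj, h1]
    · exact h2 j (lt_of_le_of_ne (Fin.le_last j) hj)
  · intro hg i hi
    obtain rfl : i = Fin.last m := by ext; simp; omega
    refine ⟨by simp [hg], fun j hj => ?_⟩
    rw [hg, if_neg hj.ne]

lemma mem_leviUnipotent_last_iff_vecMul {m : ℕ} {g : GL (Fin (m + 1)) F} :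
    g ∈ leviUnipotent F (Nat.le_succ m) ↔
      Pi.single (Fin.last m) 1 ᵥ* g.val = Pi.single (Fin.last m) 1 := by
  rw [mem_leviUnipotent_last, funext_iff]
  simp [Pi.single_apply]

/-- Enlarging the unipotent block by one amounts to a condition on the upper left block. -/
lemma mem_leviUnipotent_iff_succ {m : ℕ} (h : m + 1 ≤ n) (p : parabolic F n (m + 1))
    (hp : (p : GL (Fin n) F) ∈ leviUnipotent F h) :
    (p : GL (Fin n) F) ∈ leviUnipotent F (m.le_succ.trans h) ↔
      leviFst h p ∈ leviUnipotent F (Nat.le_succ m) := by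
  rw [mem_leviUnipotent, mem_leviUnipotent]
  constructor
  · intro H i hi
    refine ⟨(H (Fin.castLE h i) hi).1, fun j hj => (H (Fin.castLE h i) hi).2 _ hj⟩
  · intro H i hi
    by_cases him : (i : ℕ) < m + 1
    · obtain ⟨h1, h2⟩ := H ⟨i, him⟩ hi
      refine ⟨h1, fun j hj => h2 ⟨j, lt_trans (Fin.lt_def.1 hj) him⟩ hj⟩
    · exact (mem_leviUnipotent h).1 hp i (not_lt.1 him)

lemma leviUnipotent_succ_le {m : ℕ} (h : m + 1 ≤ n) :
    leviUnipotent F (m.le_succ.trans h) ≤ leviUnipotent F h := by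
  intro g hg
  rw [mem_leviUnipotent] at hg ⊢
  exact fun i hi => hg i (by omega)

lemma blockDiag_mem_leviUnipotent {m : ℕ} (h : m ≤ n) (y : GL (Fin m) F) :
    blockDiag h y 1 ∈ leviUnipotent F h := by
  refine (coe_mem_leviUnipotent h ⟨_, blockDiag_mem h y 1⟩).2 ?_
  rw [leviSnd_blockDiag]
  exact one_mem _

/-- Both orders are multiples of the order of the kernel of the projection to the upper left
block. -/
lemma card_leviUnipotent_mul [Finite F] {m : ℕ} (h : m + 1 ≤ n) :
    Nat.card (leviUnipotent F h) * Nat.card (leviUnipotent F (n := m + 1) (Nat.le_succ m)) =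
      Nat.card (GL (Fin (m + 1)) F) * Nat.card (leviUnipotent F (m.le_succ.trans h)) := by
  have := Fintype.ofFinite F
  classical
  let π : leviUnipotent F h →* GL (Fin (m + 1)) F :=
    (leviFst h).comp (Subgroup.inclusion (leviUnipotent_le h))
  have hπ : Function.Surjective π := fun y =>
    ⟨⟨blockDiag h y 1, blockDiag_mem_leviUnipotent h y⟩, leviFst_blockDiag h y 1⟩
  have h1 := card_comap_of_surjective π hπ ⊤
  have h2 := card_comap_of_surjective π hπ (leviUnipotent F (Nat.le_succ m))
  rw [Subgroup.comap_top, Subgroup.card_top, Subgroup.card_top] at h1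
  have h3 : Nat.card ((leviUnipotent F (Nat.le_succ m)).comap π) =
      Nat.card (leviUnipotent F (m.le_succ.trans h)) :=
    Nat.card_congr
      ⟨fun p => ⟨p.1.1, (mem_leviUnipotent_iff_succ h ⟨p.1.1, leviUnipotent_le h p.1.2⟩
        p.1.2).2 p.2⟩,
      fun p => ⟨⟨p.1, leviUnipotent_succ_le h p.2⟩, (mem_leviUnipotent_iff_succ h
        ⟨p.1, leviUnipotent_le h (leviUnipotent_succ_le h p.2)⟩
        (leviUnipotent_succ_le h p.2)).1 p.2⟩,
      fun p => rfl, fun p => rfl⟩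
  rw [h1, ← h3, h2]
  ring

end LeviUnipotent

/-! ### Removing one row from the unipotent block -/

section Superdiagonal

variable {F : Type*} [Field F] {n : ℕ}

/-- The product of `ν` over the superdiagonal entries in the rows `≥ m` (counted from `0`). -/
noncomputable def superdiagChar (ν : AddChar F ℂ) (m : ℕ) (A : Matrix (Fin n) (Fin n) F) : ℂ :=
  ∏ i : Fin (n - 1), if m ≤ (i : ℕ) then ν (A ⟨i, by omega⟩ ⟨i + 1, by omega⟩) else 1

lemma superdiagChar_of_lt (ν : AddChar F ℂ) {m : ℕ} (h : m + 1 < n)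
    (A : Matrix (Fin n) (Fin n) F) :
    superdiagChar ν m A =
      ν (A ⟨m, by omega⟩ ⟨m + 1, h⟩) * superdiagChar ν (m + 1) A := by
  unfold superdiagChar
  have hm : (⟨m, by omega⟩ : Fin (n - 1)) ∈ Finset.univ := Finset.mem_univ _
  rw [← Finset.mul_prod_erase _ _ hm, ← Finset.mul_prod_erase Finset.univ
    (fun i : Fin (n - 1) =>
      if m + 1 ≤ (i : ℕ) then ν (A ⟨i, by omega⟩ ⟨i + 1, by omega⟩) else 1) hm]
  rw [if_pos le_rfl, if_neg (by simp), one_mul]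
  congr 1
  refine Finset.prod_congr rfl fun i hi => ?_
  have hne : (i : ℕ) ≠ m := fun h => Finset.ne_of_mem_erase hi (Fin.ext h)
  refine if_congr ?_ rfl rfl
  omega

lemma superdiagChar_of_le (ν : AddChar F ℂ) {m : ℕ} (h : n ≤ m + 1)
    (A : Matrix (Fin n) (Fin n) F) : superdiagChar ν m A = 1 :=
  Finset.prod_eq_one fun i _ => if_neg (by omega)

end Superdiagonal

section Step

variable {F : Type*} [Field F] {n : ℕ}

/-- Every nonzero row vector is the last row of an invertible matrix, written as an inverse. -/
lemma exists_inv_last_row {m : ℕ} (φ : Fin (m + 1) → F) (hφ : φ ≠ 0) :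
    ∃ y : GL (Fin (m + 1)) F, Pi.single (Fin.last m) 1 ᵥ* (y⁻¹).val = φ := by
  obtain ⟨i, hi⟩ := Function.ne_iff.1 hφ
  set M : Matrix (Fin (m + 1)) (Fin (m + 1)) F :=
    (Matrix.updateRow 1 i φ).submatrix (Equiv.swap i (Fin.last m)) id with hM
  have hdet : M.det ≠ 0 := by
    rw [hM, Matrix.det_permute, ← Matrix.cramer_transpose_apply]
    have hs : ((Equiv.Perm.sign (Equiv.swap i (Fin.last m)) : ℤ) : F) ≠ 0 := by
      rcases Int.units_eq_one_or (Equiv.Perm.sign (Equiv.swap i (Fin.last m))) with h | h <;>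
        simp [h]
    refine mul_ne_zero hs ?_
    simpa using hi
  refine ⟨(Matrix.GeneralLinearGroup.mkOfDetNeZero M hdet)⁻¹, ?_⟩
  rw [inv_inv, Matrix.single_one_vecMul]
  ext j
  change M (Fin.last m) j = φ j
  simp [hM]

/-- The upper left block of size `m`. -/
def topBlock {m : ℕ} (h : m ≤ n) (A : Matrix (Fin n) (Fin n) F) : Matrix (Fin m) (Fin m) F :=
  A.submatrix (Fin.castLE h) (Fin.castLE h)

lemma blockDiag_conj_topBlock {m : ℕ} (h : m ≤ n) (y : GL (Fin m) F) (g : GL (Fin n) F) :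
    topBlock h ((blockDiag h y 1)⁻¹ * g * blockDiag h y 1).val =
      (y⁻¹).val * topBlock h g.val * y.val := by
  rw [blockDiag_conj]
  ext i j
  simp only [topBlock, Matrix.submatrix_apply, ← splitEquiv_inl h]
  simp

lemma blockDiag_conj_apply_right {m : ℕ} (h : m ≤ n) (y : GL (Fin m) F) (g : GL (Fin n) F)
    (i : Fin m) (j : Fin n) (hj : m ≤ (j : ℕ)) :
    ((blockDiag h y 1)⁻¹ * g * blockDiag h y 1).val (Fin.castLE h i) j =
      ((y⁻¹).val *ᵥ fun i => g.val (Fin.castLE h i) j) i := by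
  obtain ⟨j, rfl⟩ := (splitEquiv h).surjective j
  rcases j with j | j
  · simp [splitEquiv_inl] at hj; omega
  · rw [blockDiag_conj, ← splitEquiv_inl h]
    simp only [Matrix.reindex_apply, Matrix.submatrix_apply, Equiv.symm_apply_apply,
      Matrix.fromBlocks_apply₁₂]
    simp only [Matrix.mul_apply, Matrix.submatrix_apply, Matrix.mulVec, dotProduct,
      splitEquiv_inr]

lemma blockDiag_conj_apply_of_le {m : ℕ} (h : m ≤ n) (y : GL (Fin m) F) (g : GL (Fin n) F)
    (i j : Fin n) (hi : m ≤ (i : ℕ)) (hj : m ≤ (j : ℕ)) :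
    ((blockDiag h y 1)⁻¹ * g * blockDiag h y 1).val i j = g.val i j := by
  obtain ⟨i, rfl⟩ := (splitEquiv h).surjective i
  obtain ⟨j, rfl⟩ := (splitEquiv h).surjective j
  rcases i with i | i
  · simp [splitEquiv_inl] at hi; omega
  · rcases j with j | j
    · simp [splitEquiv_inl] at hj; omega
    · rw [blockDiag_conj]
      simp only [Matrix.reindex_apply, Matrix.submatrix_apply, Equiv.symm_apply_apply,
        Matrix.fromBlocks_apply₂₂]
      simp only [splitEquiv_inr]

lemma blockDiag_conj_mem_iff {m : ℕ} (h : m + 1 ≤ n) (g : GL (Fin n) F)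
    (hg : g ∈ leviUnipotent F h) (y : GL (Fin (m + 1)) F) :
    (blockDiag h y 1)⁻¹ * g * blockDiag h y 1 ∈ leviUnipotent F (m.le_succ.trans h) ↔
      y⁻¹ * leviFst h ⟨g, leviUnipotent_le h hg⟩ * y ∈ leviUnipotent F (Nat.le_succ m) := by
  have hd := blockDiag_mem_leviUnipotent h y
  have hg' := mul_mem (mul_mem (inv_mem hd) hg) hd
  have h1 : leviFst h ⟨_, leviUnipotent_le h hg'⟩ =
      y⁻¹ * leviFst h ⟨g, leviUnipotent_le h hg⟩ * y := by
    ext i j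
    exact congrFun (congrFun (blockDiag_conj_topBlock h y g) i) j
  rw [← h1]
  exact mem_leviUnipotent_iff_succ h ⟨_, leviUnipotent_le h hg'⟩ hg'

variable [Fintype F]

/-- The signed Möbius number of the upper left block of size `k` times the product of `ν` over
the superdiagonal entries in the rows `≥ m`. -/
noncomputable def blockChar (ν : AddChar F ℂ) {k : ℕ} (h : k ≤ n) (m : ℕ)
    (g : GL (Fin n) F) : ℂ :=
  steinbergEnd (Matrix.toLin' (topBlock h g.val)) * superdiagChar ν m g.val

/-- On `leviUnipotent F h`, the upper left block of size `m + 1` has last row `(0, …, 0, 1)`. -/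
lemma steinbergEnd_topBlock_succ {m : ℕ} (h : m < n) {g : GL (Fin n) F}
    (hg : g ∈ leviUnipotent F h.le) :
    steinbergEnd (Matrix.toLin' (topBlock (Nat.succ_le_of_lt h) g.val)) =
      Nat.card {w : Fin m → F // topBlock h.le g.val *ᵥ w +
        (fun i => g.val (Fin.castLE h.le i) ⟨m, h⟩) = w} *
      steinbergEnd (Matrix.toLin' (topBlock h.le g.val)) := by
  refine steinbergEnd_toLin'_of_last_row (topBlock (Nat.succ_le_of_lt h) g.val) fun j => ?_
  obtain ⟨h1, h2⟩ := (mem_leviUnipotent h.le).1 hg ⟨m, h⟩ le_rfl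
  split_ifs with hj
  · rw [hj]; exact h1
  · exact h2 (Fin.castLE _ j) (lt_of_le_of_ne (Fin.le_last j) hj : j < Fin.last m)

lemma steinbergEnd_toLin'_conj {m : ℕ} (y : GL (Fin m) F) (A : Matrix (Fin m) (Fin m) F) :
    steinbergEnd (Matrix.toLin' ((y⁻¹).val * A * y.val)) = steinbergEnd (Matrix.toLin' A) := by
  let e : (Fin m → F) ≃ₗ[F] (Fin m → F) :=
    { Matrix.toLin' y.val with
      invFun := fun w => (y⁻¹).val *ᵥ w
      left_inv := inv_mulVec_mulVec y
      right_inv := mulVec_inv_mulVec y }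
  refine steinbergEnd_conj e _ _ fun w => ?_
  change y.val *ᵥ (((y⁻¹).val * A * y.val) *ᵥ w) = A *ᵥ (y.val *ᵥ w)
  rw [← Matrix.mulVec_mulVec, ← Matrix.mulVec_mulVec, mulVec_inv_mulVec]

/-- Conjugation by `diag(y, 1)` affects the rows `≥ m` of the superdiagonal only in row `m`,
where the last entry of `y⁻¹ v` appears, `v` being the part of column `m + 1` in the first
`m + 1` rows. -/
lemma blockChar_blockDiag_conj (ν : AddChar F ℂ) {m : ℕ} (h : m + 1 < n) (g : GL (Fin n) F)
    (y : GL (Fin (m + 1)) F) :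
    blockChar ν h.le m ((blockDiag h.le y 1)⁻¹ * g * blockDiag h.le y 1) =
      blockChar ν h.le (m + 1) g *
        ν (((y⁻¹).val *ᵥ fun i => g.val (Fin.castLE h.le i) ⟨m + 1, h⟩) (Fin.last m)) := by
  have h1 : ((blockDiag h.le y 1)⁻¹ * g * blockDiag h.le y 1).val ⟨m, by omega⟩ ⟨m + 1, h⟩ =
      ((y⁻¹).val *ᵥ fun i => g.val (Fin.castLE h.le i) ⟨m + 1, h⟩) (Fin.last m) :=
    blockDiag_conj_apply_right h.le y g (Fin.last m) ⟨m + 1, h⟩ le_rfl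
  have h2 : superdiagChar ν (m + 1) ((blockDiag h.le y 1)⁻¹ * g * blockDiag h.le y 1).val =
      superdiagChar ν (m + 1) g.val := by
    refine Finset.prod_congr rfl fun i _ => ?_
    split_ifs with hi
    · rw [blockDiag_conj_apply_of_le h.le y g _ _ hi (Nat.le_succ_of_le hi)]
    · rfl
  rw [blockChar, blockChar, blockDiag_conj_topBlock, steinbergEnd_toLin'_conj,
    superdiagChar_of_lt ν h, h2, ← h1]
  ring

variable [DecidableEq F]

open Classical in
/-- The nonzero row vectors are the last rows of the matrices `y⁻¹`, and those fixed by `a`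
correspond to the `y` for which `y⁻¹ a y` has last row `(0, …, 0, 1)`. -/
lemma sum_addChar_leviUnipotent (ν : AddChar F ℂ) (hν : ν ≠ 1) {m : ℕ}
    (a : GL (Fin (m + 1)) F) (v : Fin (m + 1) → F) :
    ∑ y : GL (Fin (m + 1)) F, (if y⁻¹ * a * y ∈ leviUnipotent F (Nat.le_succ m) then
        ν (((y⁻¹).val *ᵥ v) (Fin.last m)) else 0) =
      Nat.card (leviUnipotent F (n := m + 1) (Nat.le_succ m)) *
        (Nat.card {w : Fin (m + 1) → F // a.val *ᵥ w + v = w} - 1) := by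
  set e : Fin (m + 1) → F := Pi.single (Fin.last m) 1 with he
  have hne : ∀ y : GL (Fin (m + 1)) F, e ᵥ* (y⁻¹).val ≠ 0 := by
    intro y h0
    have h1 : e ᵥ* (y⁻¹).val ᵥ* y.val = e := by
      rw [Matrix.vecMul_vecMul, ← Units.val_mul]; simp
    rw [h0, Matrix.zero_vecMul] at h1
    have := congrFun h1 (Fin.last m)
    simp [he] at this
  have h1 : ∀ y : GL (Fin (m + 1)) F,
      (if y⁻¹ * a * y ∈ leviUnipotent F (Nat.le_succ m) then
        ν (((y⁻¹).val *ᵥ v) (Fin.last m)) else 0) =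
      if (e ᵥ* (y⁻¹).val) ᵥ* a.val = e ᵥ* (y⁻¹).val then ν ((e ᵥ* (y⁻¹).val) ⬝ᵥ v) else 0 := by
    intro y
    rw [mem_leviUnipotent_last_iff_vecMul, ← he, ← dotProduct_mulVec]
    have h2 : e ⬝ᵥ ((y⁻¹).val *ᵥ v) = ((y⁻¹).val *ᵥ v) (Fin.last m) := by
      rw [he, single_dotProduct, one_mul]
    rw [h2]
    suffices h3 : e ᵥ* (y⁻¹ * a * y).val = e ↔
        (e ᵥ* (y⁻¹).val) ᵥ* a.val = e ᵥ* (y⁻¹).val by simp only [h3]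
    rw [Units.val_mul, Units.val_mul, ← Matrix.vecMul_vecMul, ← Matrix.vecMul_vecMul]
    constructor
    · intro h3
      conv_rhs => rw [← h3]
      rw [Matrix.vecMul_vecMul _ y.val, ← Units.val_mul]
      simp
    · intro h3
      rw [h3, Matrix.vecMul_vecMul, ← Units.val_mul]
      simp
  rw [Finset.sum_congr rfl fun y _ => h1 y,
    sum_comp_eq_card_mul_sum (Ω := {φ : Fin (m + 1) → F // φ ≠ 0})
      (leviUnipotent F (Nat.le_succ m)) (fun y => ⟨e ᵥ* (y⁻¹).val, hne y⟩)
      (fun φ => (exists_inv_last_row φ.1 φ.2).imp fun y hy => Subtype.ext hy) ?_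
      (fun φ => if φ.1 ᵥ* a.val = φ.1 then ν (φ.1 ⬝ᵥ v) else 0)]
  · congr 1
    rw [card_affine_fixed ν hν, ← Finset.sum_subtype (Finset.univ.erase 0) (by simp)
      (fun φ : Fin (m + 1) → F => if φ ᵥ* a.val = φ then ν (φ ⬝ᵥ v) else 0),
      ← Finset.add_sum_erase _ _ (Finset.mem_univ (0 : Fin (m + 1) → F))]
    simp
  · intro x y
    rw [Subtype.mk_eq_mk, mem_leviUnipotent_last_iff_vecMul, ← he, Units.val_mul,
      ← Matrix.vecMul_vecMul]
    constructor
    · intro h3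
      rw [h3, Matrix.vecMul_vecMul, ← Units.val_mul]
      simp
    · intro h3
      rw [← congrArg (fun u => u ᵥ* (y⁻¹).val) h3]
      simp only [Matrix.vecMul_vecMul, ← Units.val_mul]
      simp

open Classical in
/-- Extending the upper left block by a further row and column multiplies the signed Möbius number
by a number of fixed points, hence by a sum over row vectors. The zero row vector gives the first
summand on the right. The nonzero ones amount to an average over the conjugates by `diag(y, 1)`,
which gives the second summand, with one more row in the unipotent block. -/
theorem induced_blockChar_succ (ν : AddChar F ℂ) (hν : ν ≠ 1) {m : ℕ} (h : m + 1 < n)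
    (g : GL (Fin n) F) :
    induced (leviUnipotent F h.le)
        (fun x => blockChar ν (Nat.succ_le_of_lt h) (m + 1) (x : GL (Fin n) F)) g =
      induced (leviUnipotent F h.le) (fun x => blockChar ν h.le (m + 1) (x : GL (Fin n) F)) g +
      induced (leviUnipotent F (m.le_succ.trans h.le))
        (fun x => blockChar ν h.le m (x : GL (Fin n) F)) g := by
  have key : ∀ z : GL (Fin n) F,
      ∑ y : GL (Fin (m + 1)) F,
        (if (blockDiag h.le y 1)⁻¹ * z * blockDiag h.le y 1 ∈
            leviUnipotent F (m.le_succ.trans h.le) then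
          blockChar ν h.le m ((blockDiag h.le y 1)⁻¹ * z * blockDiag h.le y 1) else 0) =
      Nat.card (leviUnipotent F (n := m + 1) (Nat.le_succ m)) *
        ((if z ∈ leviUnipotent F h.le then blockChar ν (Nat.succ_le_of_lt h) (m + 1) z else 0) -
          if z ∈ leviUnipotent F h.le then blockChar ν h.le (m + 1) z else 0) := by
    intro z
    by_cases hz : z ∈ leviUnipotent F h.le
    · have h1 := sum_addChar_leviUnipotent ν hν (leviFst h.le ⟨z, leviUnipotent_le h.le hz⟩)
        (fun i => z.val (Fin.castLE h.le i) ⟨m + 1, h⟩)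
      have h2 : (leviFst h.le ⟨z, leviUnipotent_le h.le hz⟩).val = topBlock h.le z.val := rfl
      rw [h2] at h1
      rw [if_pos hz, if_pos hz, blockChar, blockChar, steinbergEnd_topBlock_succ h hz]
      simp only [blockDiag_conj_mem_iff h.le z hz, blockChar_blockDiag_conj ν h, ← mul_ite_zero]
      rw [← Finset.mul_sum, h1, blockChar]
      ring
    · rw [if_neg hz, if_neg hz, sub_zero, mul_zero]
      refine Finset.sum_eq_zero fun y _ => if_neg fun h1 => hz ?_
      have hd := blockDiag_mem_leviUnipotent h.le y
      have := mul_mem (mul_mem hd (leviUnipotent_succ_le h.le h1)) (inv_mem hd)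
      simpa [mul_assoc] using this
  have h1 := card_mul_sum_eq_sum_sum
    (fun x : GL (Fin n) F => if x⁻¹ * g * x ∈ leviUnipotent F (m.le_succ.trans h.le) then
      blockChar ν h.le m (x⁻¹ * g * x) else 0)
    (fun y : GL (Fin (m + 1)) F => blockDiag h.le y 1)
  have h2 : ∀ (x : GL (Fin n) F) (y : GL (Fin (m + 1)) F),
      (x * blockDiag h.le y 1)⁻¹ * g * (x * blockDiag h.le y 1) =
      (blockDiag h.le y 1)⁻¹ * (x⁻¹ * g * x) * blockDiag h.le y 1 := by
    intro x y
    simp only [_root_.mul_inv_rev, mul_assoc]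
  simp only [h2, key] at h1
  rw [← Finset.mul_sum, Finset.sum_sub_distrib, ← Nat.card_eq_fintype_card] at h1
  have hcard : (Nat.card (leviUnipotent F h.le) : ℂ) *
      Nat.card (leviUnipotent F (n := m + 1) (Nat.le_succ m)) =
      Nat.card (GL (Fin (m + 1)) F) * Nat.card (leviUnipotent F (m.le_succ.trans h.le)) := by
    exact_mod_cast card_leviUnipotent_mul h.le
  simp only [induced_restrict]
  have n1 := natCast_card_ne_zero (leviUnipotent F h.le)
  have n2 := natCast_card_ne_zero (leviUnipotent F (n := m + 1) (Nat.le_succ m))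
  have n3 := natCast_card_ne_zero (leviUnipotent F (m.le_succ.trans h.le))
  field_simp
  apply mul_left_cancel₀ n2
  linear_combination (-(Nat.card (leviUnipotent F (m.le_succ.trans h.le)) : ℂ)) * h1 -
    (∑ x : GL (Fin n) F, if x⁻¹ * g * x ∈ leviUnipotent F (m.le_succ.trans h.le) then
      blockChar ν h.le m (x⁻¹ * g * x) else 0) * hcard

end Step

/-! ### The decomposition of the product -/

section Decomposition

variable {F : Type*} [Field F] [Fintype F] [DecidableEq F] {n : ℕ}

/-- The summand for `m` is induced from the subgroup `leviUnipotent F h` of `P_m`. -/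
lemma induced_inflated_eq {m : ℕ} (h : m ≤ n) (ν : AddChar F ℂ) (g : GL (Fin n) F) :
    induced (parabolic F n m) (inflated h (steinberg F m) (gelfandGraev (n - m) ν)) g =
      induced (leviUnipotent F h) (fun x => blockChar ν h m (x : GL (Fin n) F)) g := by
  have key := induced_mul_inflated_induced (leviSnd (F := F) h) (leviSnd_surjective h)
    (unipotent F (n - m))
    (fun u => ∏ i : Fin (n - m - 1), ν (u.val ⟨i, by omega⟩ ⟨i + 1, by omega⟩))
    (fun p => steinberg F m (leviFst h p))
    (fun p q => by rw [map_mul, map_mul, map_inv, steinberg_conj])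
    (leviUnipotent F h) (leviUnipotent_le h) (coe_mem_leviUnipotent h) g
  refine key.trans ?_
  congr 1
  funext x
  rw [steinberg_eq_steinbergEnd, blockChar]
  congr 1
  refine Finset.prod_of_injOn (fun i : Fin (n - m - 1) => (⟨m + i, by omega⟩ : Fin (n - 1)))
    (fun i _ j _ hij => by simpa [Fin.ext_iff] using hij) (by simp) ?_ ?_
  · intro k _ hk
    refine if_neg fun hmk => hk ?_
    exact ⟨⟨k - m, by omega⟩, by simp, by ext; simp; omega⟩
  · intro i _
    rw [if_pos (Nat.le_add_right m i)]
    rfl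

/-- An affine map on `F^0` has exactly one fixed point. -/
lemma induced_blockChar_zero (h : 0 < n) (ν : AddChar F ℂ) (g : GL (Fin n) F) :
    induced (leviUnipotent F h.le)
        (fun x => blockChar ν (Nat.succ_le_of_lt h) 0 (x : GL (Fin n) F)) g =
      induced (leviUnipotent F h.le) (fun x => blockChar ν h.le 0 (x : GL (Fin n) F)) g := by
  congr 1
  funext x
  rw [blockChar, blockChar, steinbergEnd_topBlock_succ h x.2]
  have : Nat.card {w : Fin 0 → F // topBlock h.le x.1.val *ᵥ w +
      (fun i => x.1.val (Fin.castLE h.le i) ⟨0, h⟩) = w} = 1 := by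
    rw [Nat.card_eq_one_iff_unique]
    exact ⟨inferInstance, ⟨⟨0, Subsingleton.elim _ _⟩⟩⟩
  rw [this, Nat.cast_one, one_mul]

lemma blockChar_self (ν : AddChar F ℂ) {m : ℕ} (h : n ≤ m + 1) (g : GL (Fin n) F) :
    blockChar ν le_rfl m g = steinberg F n g := by
  rw [steinberg_eq_steinbergEnd, blockChar, superdiagChar_of_le ν h, mul_one]
  rfl

/-- The summand for `m = n` is the Steinberg character. -/
lemma induced_blockChar_self (ν : AddChar F ℂ) (g : GL (Fin n) F) :
    induced (leviUnipotent F le_rfl) (fun x => blockChar ν le_rfl n (x : GL (Fin n) F)) g =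
      steinberg F n g := by
  have h0 : ∀ H : Subgroup (GL (Fin n) F), H = ⊤ →
      induced H (fun x => steinberg F n x) g = steinberg F n g := by
    rintro _ rfl
    exact induced_top _ (fun x y => steinberg_conj x y) g
  simp only [blockChar_self ν (Nat.le_succ n)]
  apply h0
  ext x
  simp only [mem_leviUnipotent, Subgroup.mem_top, iff_true]
  intro i hi
  omega

/-- Inducing the restriction of the Steinberg character to the stabilizer of a nonzero row
vector multiplies it by the number of nonzero fixed row vectors, which is also the number of
nonzero fixed column vectors. -/
lemma induced_blockChar_last {m : ℕ} (ν : AddChar F ℂ) (hν : ν ≠ 1) (g : GL (Fin (m + 1)) F) :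
    induced (leviUnipotent F (Nat.le_succ m))
        (fun x => blockChar ν le_rfl m (x : GL (Fin (m + 1)) F)) g =
      steinberg F (m + 1) g * (permChar F (m + 1) g - 1) := by
  classical
  have h := sum_addChar_leviUnipotent ν hν g 0
  simp only [Matrix.mulVec_zero, Pi.zero_apply, AddChar.map_zero_eq_one, add_zero] at h
  simp only [blockChar_self ν le_rfl]
  rw [induced_restrict]
  simp only [steinberg_conj]
  have h1 : ∀ x : GL (Fin (m + 1)) F,
      (if x⁻¹ * g * x ∈ leviUnipotent F (Nat.le_succ m) then steinberg F (m + 1) g else 0) =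
      steinberg F (m + 1) g *
        if x⁻¹ * g * x ∈ leviUnipotent F (Nat.le_succ m) then 1 else 0 := by
    intro x; simp
  rw [Finset.sum_congr rfl fun x _ => h1 x, ← Finset.mul_sum, h, permChar]
  have := natCast_card_ne_zero (leviUnipotent F (n := m + 1) (Nat.le_succ m))
  field_simp

/-- The telescoping sum of the identities `induced_blockChar_succ`. -/
lemma sum_induced_blockChar (ν : AddChar F ℂ) (hν : ν ≠ 1) (g : GL (Fin n) F) (m : ℕ)
    (h : m < n) :
    ∑ k : Fin (m + 1), induced (leviUnipotent F (k.is_le.trans h.le))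
        (fun x => blockChar ν (k.is_le.trans h.le) k (x : GL (Fin n) F)) g =
      induced (leviUnipotent F h.le)
        (fun x => blockChar ν (Nat.succ_le_of_lt h) m (x : GL (Fin n) F)) g := by
  induction m with
  | zero =>
    rw [induced_blockChar_zero h]
    simp
  | succ m ih =>
    rw [Fin.sum_univ_castSucc, induced_blockChar_succ ν hν h, add_comm]
    congr 1
    exact ih (Nat.lt_of_succ_lt h)

end Decomposition

end GLChar

theorem theorem6p2 {F : Type*} [Field F] [Fintype F] [DecidableEq F] (n : ℕ) (hn : 1 ≤ n)
    (ν : AddChar F ℂ) (hν : ν ≠ 1) :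
    GLChar.permChar F n * GLChar.steinberg F n =
      ∑ m : Fin (n + 1),
        GLChar.induced (GLChar.parabolic F n m)
          (GLChar.inflated m.is_le (GLChar.steinberg F m) (GLChar.gelfandGraev (n - m) ν)) := by
  obtain ⟨m, rfl⟩ : ∃ m, n = m + 1 := ⟨n - 1, by omega⟩
  funext g
  rw [Finset.sum_apply, Fin.sum_univ_castSucc, Pi.mul_apply]
  have h1 := GLChar.sum_induced_blockChar ν hν g m (Nat.lt_succ_self m)
  rw [GLChar.induced_blockChar_last ν hν g] at h1
  have h2 := (GLChar.induced_inflated_eq le_rfl ν g).trans (GLChar.induced_blockChar_self ν g)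
  have h3 : ∀ k : Fin (m + 1), GLChar.induced (GLChar.parabolic F (m + 1) k.castSucc)
      (GLChar.inflated k.castSucc.is_le (GLChar.steinberg F k.castSucc)
        (GLChar.gelfandGraev (m + 1 - k.castSucc) ν)) g = _ :=
    fun k => GLChar.induced_inflated_eq k.castSucc.is_le ν g
  rw [Finset.sum_congr rfl fun k _ => h3 k]
  refine Eq.trans ?_ (congrArg₂ (· + ·) h1.symm h2.symm)
  ring
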